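/- Let $q$ be a prime power, $n\ge 1$, $V$ a $3$-dimensional vector space over $\mathbb F_{q^n}$, and $W\le V$ a $2$-dimensional $\mathbb F_{q^n}$-subspace, so that $\ell=\mathrm{PG}(W,\mathbb F_{q^n})$ is a line of the plane $\mathrm{PG}(V,\mathbb F_{q^n})=\mathrm{PG}(2,q^n)$. For a subfield $\mathbb F$ of $\mathbb F_{q^n}$ and an $\mathbb F$-subspace $U$ of $W$ (or of $V$) put $L_U=\{\langle \mathbf u\rangle_{\mathbb F_{q^n}} : \mathbf u\in U\setminus\{\mathbf 0\}\}$; such a point set is called an $\mathbb F$-linear set. Let $U$ be an $n$-dimensional $\mathbb F_q$-subspace of $W$ such that the maximum field of linearity of $L_U$ is $\mathbb F_q$, i.e. $t=1$ is the largest integer for which $\mathbb F_{q^t}\subseteq \mathbb F_{q^n}$ and $L_U$ is an $\mathbb F_{q^t}$-linear set. The $\Gamma\mathrm L$-class of $L_U$ is the largest integer $s$ such that there are $\mathbb F_q$-subspaces $U_1,\dots,U_s$ of $W$ with $L_{U_i}=L_U$ for all $i$ and such that for all $i\ne j$ there is no invertible semilinear map $f\in\Gamma\mathrm L(W,\mathbb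 F_{q^n})$ with $U_i=U_j^f$. A blocking set of $\mathrm{PG}(V,\mathbb F_{q^n})$ is a point set meeting every line; it is of Rédei type with Rédei line $\ell$ if, for some $N$, it has $q^n+N\le 2q^n$ points, exactly $N$ of which lie on $\ell$. Two blocking sets are equivalent if an element of $\mathrm{P\Gamma L}(V,\mathbb F_{q^n})$ maps one onto the other. **Theorem.** The $\Gamma\mathrm L$-class of $L_U$ equals the number of equivalence classes of $\mathbb F_q$-linear blocking sets $\mathcal B$ of Rédei type of $\mathrm{PG}(V,\mathbb F_{q^n})$ that have $\ell$ as a Rédei line and satisfy $\mathcal B\cap \ell=L_U$. -/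

import Mathlib

open scoped LinearAlgebra.Projectivization

/-- The set `L_U` of the points `⟨u⟩_E` of the projective space `PG(V, E)`, where `u` runs through
the non-zero vectors of the `F`-subspace `U` of `V` (`F` a subfield of `E`). -/
def linearSet {E V : Type*} [Field E] [AddCommGroup V] [Module E V] {F : Subfield E}
    (U : Submodule F V) : Set (ℙ E V) :=
  {P | ∃ (u : V) (hu : u ≠ 0), u ∈ U ∧ Projectivization.mk E u hu = P}

/-- `L` is an `F`-linear set of `PG(V, E)`. -/
def IsFieldLinearSet {E V : Type*} [Field E] [AddCommGroup V] [Module E V] (F : Subfield E)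
    (L : Set (ℙ E V)) : Prop :=
  ∃ U : Submodule F V, linearSet U = L

/-- Among the fields `F'` with `F ≤ F' ≤ E`, the largest one over which `L` is a linear set
is `M`. -/
def IsMaxFieldOfLinearity {E V : Type*} [Field E] [AddCommGroup V] [Module E V]
    (F M : Subfield E) (L : Set (ℙ E V)) : Prop :=
  (F ≤ M ∧ IsFieldLinearSet M L) ∧
    ∀ F' : Subfield E, F ≤ F' → IsFieldLinearSet F' L → Nat.card F' ≤ Nat.card M

/-- Some element of `ΓL(V, E)`, that is, some bijective semilinear map of `V` with an arbitrary
companion automorphism of `E`, maps `A` onto `B`. -/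
def GammaLEquivalent (E : Type*) {V : Type*} [Field E] [AddCommGroup V] [Module E V]
    (A B : Set V) : Prop :=
  ∃ (σ : E ≃+* E) (f : V →ₛₗ[(σ : E →+* E)] V), Function.Bijective f ∧ f '' A = B

/-- `s` is the `ΓL`-class of the set `L` of points of `PG(W, E)`: the largest number of
`F`-subspaces of `W` that all define `L` and lie in pairwise different orbits of `ΓL(W, E)`. -/
def HasGammaLClass {E W : Type*} [Field E] [AddCommGroup W] [Module E W] (F : Subfield E)
    (L : Set (ℙ E W)) (s : ℕ) : Prop :=
  IsGreatest {r : ℕ | ∃ U : Fin r → Submodule F W, (∀ i, linearSet (U i) = L) ∧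
    ∀ i j, i ≠ j → ¬ GammaLEquivalent E (U i : Set W) (U j : Set W)} s

/-- Some collineation of `PG(V, E)` in `PΓL(V, E)` maps the point set `A` onto `B`. -/
def PGammaLEquivalent {E V : Type*} [Field E] [AddCommGroup V] [Module E V]
    (A B : Set (ℙ E V)) : Prop :=
  ∃ (σ : E ≃+* E) (f : V →ₛₗ[(σ : E →+* E)] V) (hf : Function.Bijective f),
    Projectivization.map f hf.injective '' A = B

theorem PGammaLEquivalent.refl {E V : Type*} [Field E] [AddCommGroup V] [Module E V]
    (A : Set (ℙ E V)) : PGammaLEquivalent A A := by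
  refine ⟨RingEquiv.refl E, ⟨⟨id, fun _ _ => rfl⟩, fun _ _ => rfl⟩, Function.bijective_id, ?_⟩
  ext P
  constructor
  · rintro ⟨Q, hQ, rfl⟩
    induction Q using Projectivization.ind with
    | h v hv => exact hQ
  · intro hP
    refine ⟨P, hP, ?_⟩
    induction P using Projectivization.ind with
    | h v hv => rfl

theorem PGammaLEquivalent.symm {E V : Type*} [Field E] [AddCommGroup V] [Module E V]
    {A B : Set (ℙ E V)} (h : PGammaLEquivalent A B) : PGammaLEquivalent B A := by
  obtain ⟨σ, f, hf, rfl⟩ := h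
  let e := Equiv.ofBijective f hf
  have he : ∀ v, f (e.symm v) = v := fun v => e.apply_symm_apply v
  have he' : ∀ v, e.symm (f v) = v := fun v => e.symm_apply_apply v
  refine ⟨σ.symm, ⟨⟨e.symm, fun x y => hf.injective ?_⟩, fun a x => hf.injective ?_⟩,
    e.symm.bijective, ?_⟩
  · simp [he]
  · simp [he, map_smulₛₗ]
  · have key : ∀ Q : ℙ E V, Projectivization.map (σ := ((σ.symm : E ≃+* E) : E →+* E))
        ⟨⟨e.symm, fun x y => hf.injective (by simp [he])⟩,
          fun a x => hf.injective (by simp [he, map_smulₛₗ])⟩ e.symm.bijective.injective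
        (Projectivization.map f hf.injective Q) = Q := by
      intro Q
      induction Q using Projectivization.ind with
      | h v hv =>
        simp only [Projectivization.map_mk]
        congr 1
        exact he' v
    rw [Set.image_image]
    exact (Set.image_congr fun Q _ => key Q).trans (Set.image_id' A)

theorem PGammaLEquivalent.trans {E V : Type*} [Field E] [AddCommGroup V] [Module E V]
    {A B C : Set (ℙ E V)} (h : PGammaLEquivalent A B) (h' : PGammaLEquivalent B C) :
    PGammaLEquivalent A C := by
  obtain ⟨σ, f, hf, rfl⟩ := h
  obtain ⟨τ, g, hg, rfl⟩ := h'
  refine ⟨σ.trans τ, ⟨⟨g ∘ f, fun x y => by simp⟩, fun a x => by simp [map_smulₛₗ]⟩,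
    hg.comp hf, ?_⟩
  rw [Set.image_image]
  refine Set.image_congr fun Q _ => ?_
  induction Q using Projectivization.ind with
  | h v hv => rfl

/-- The points of `PG(V, E)` that lie in `PG(W, E)`, for an `E`-subspace `W` of `V`. -/
def pointsOf {E V : Type*} [Field E] [AddCommGroup V] [Module E V] (W : Submodule E V) :
    Set (ℙ E V) :=
  {P | P.submodule ≤ W}

/-- `B` meets every line. -/
def IsBlockingSet {E V : Type*} [Field E] [AddCommGroup V] [Module E V]
    (B : Set (ℙ E V)) : Prop :=
  ∀ l : Submodule E V, Module.finrank E l = 2 → (B ∩ pointsOf l).Nonempty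

/-- The line `PG(l, E)` is a Rédei line of `B`: for some `N`, `B` has `|E| + N ≤ 2|E|` points and
`N` of them are on the line. -/
def IsRedeiLine {E V : Type*} [Field E] [AddCommGroup V] [Module E V]
    (B : Set (ℙ E V)) (l : Submodule E V) : Prop :=
  Module.finrank E l = 2 ∧ ∃ N : ℕ, B.ncard = Nat.card E + N ∧ Nat.card E + N ≤ 2 * Nat.card E ∧
    (B ∩ pointsOf l).ncard = N

/-- `B` is an `F`-linear blocking set of Rédei type of `PG(V, E)` that has `PG(W, E)` as a Rédei
line and meets this line exactly in `L`. -/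
structure IsLinearRedeiBlockingSetOver {E V : Type*} [Field E] [AddCommGroup V] [Module E V]
    (F : Subfield E) (W : Submodule E V) (L : Set (ℙ E W)) (B : Set (ℙ E V)) : Prop where
  isLinearSet : IsFieldLinearSet F B
  isBlockingSet : IsBlockingSet B
  isRedeiLine : IsRedeiLine B W
  inter_eq : B ∩ pointsOf W = Projectivization.map W.subtype W.injective_subtype '' L

/-- `PΓL`-equivalence on the linear blocking sets of Rédei type that meet the Rédei line
`PG(W, E)` in `L`. -/
def redeiBlockingSetSetoid {E V : Type*} [Field E] [AddCommGroup V] [Module E V]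
    (F : Subfield E) (W : Submodule E V) (L : Set (ℙ E W)) :
    Setoid {B : Set (ℙ E V) // IsLinearRedeiBlockingSetOver F W L B} where
  r A B := PGammaLEquivalent A.1 B.1
  iseqv := ⟨fun A => .refl A.1, fun h => h.symm, fun h h' => h.trans h'⟩

/-- The number of pairwise inequivalent `F`-linear blocking sets of Rédei type of `PG(V, E)` that
meet the Rédei line `PG(W, E)` in `L`. -/
noncomputable def numInequivalentRedeiBlockingSets {E V : Type*} [Field E] [AddCommGroup V]
    [Module E V] (F : Subfield E) (W : Submodule E V) (L : Set (ℙ E W)) : ℕ :=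
  Nat.card (Quotient (redeiBlockingSetSetoid F W L))

/-! Write `q = |F|` and `n = [E : F]`, and call the rank of the `F`-space of vectors of `U` on a
point the weight of that point. If `U'` has rank `n`, defines `L_U`, and `v` lies outside `W`, then
the points off the line defined by `U' + F v` are the `q ^ n` points `⟨v + u⟩` with `u` in `U'`. So
this space gives a Rédei blocking set from which `U'` can be read off. The theorem says that this
construction is a bijection between orbits of subspaces defining `L_U` and classes of blocking sets.
Two points need work.

Every subspace defining `L_U` must have rank `n` (`finrank_eq_of_linearSet_eq`). In suitable
coordinates `U` is the graph of an `F`-linear map `f`, and the points of `L_U` are the directions of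
the graph. The Rédei polynomial `∏ (X - f z + Y z)` is a `q`-polynomial in `X`, and when there are
few directions many of its coefficients vanish. Hence a point of weight `w` forces at least `q ^ (n
- w)` points, and if `d` is the least weight, then `U + P` is closed under the field of order `q ^
d` for each `P` of weight `d`. A count of vectors then makes `U` itself closed
(`smul_mem_of_pow_eq`). By maximality of `F` this gives `d = 1`, so `L_U` has at least `q ^ (n - 1)`
points, too many for a subspace of rank below `n`. Rank above `n` would give the whole line.

A collineation between two cones need not fix the line. If it moves it, the line meets its image in
a single point, and that point has weight at least `n - 1` in the target
(`exists_heavy_point_of_map_notMem`). Applied also to the inverse, this puts such a point in both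
subspaces, and two subspaces of this kind are equivalent anyway, since any two `F`-hyperplanes of
`E` are multiples of each other (`gammaLEquivalent_of_heavy_points`). -/

/-! ### Linearized polynomials as products of linear factors over subspaces. -/

section LinearizedPolynomials

open Polynomial

/-- The `q`-polynomial `∑ j ≤ m, c j * X ^ (q ^ j)`. -/
noncomputable def qPolynomial {A : Type*} [CommRing A] (q m : ℕ) (c : ℕ → A) : A[X] :=
  ∑ j ∈ Finset.range (m + 1), C (c j) * X ^ (q ^ j)

theorem coeff_qPolynomial {A : Type*} [CommRing A] {q : ℕ} (hq : 1 < q) (m : ℕ) (c : ℕ → A)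
    (j : ℕ) : (qPolynomial q m c).coeff (q ^ j) = if j ≤ m then c j else 0 := by
  simp only [qPolynomial, finsetSum_coeff, coeff_C_mul, coeff_X_pow,
    (Nat.pow_right_injective hq).eq_iff, mul_ite, mul_one, mul_zero, Finset.sum_ite_eq,
    Finset.mem_range, Nat.lt_succ_iff]

theorem eval_qPolynomial {A : Type*} [CommRing A] (q m : ℕ) (c : ℕ → A) (x : A) :
    (qPolynomial q m c).eval x = ∑ j ∈ Finset.range (m + 1), c j * x ^ (q ^ j) := by
  simp [qPolynomial, eval_finsetSum]

theorem map_qPolynomial {A B : Type*} [CommRing A] [CommRing B] (g : A →+* B) (q m : ℕ)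
    (c : ℕ → A) : (qPolynomial q m c).map g = qPolynomial q m fun j => g (c j) := by
  simp [qPolynomial, Polynomial.map_sum]

/-- The product of all `X - c` over the elements of a finite field. -/
theorem prod_X_sub_C_eq_X_pow_card_sub_X (K : Type*) [Field K] [Fintype K] :
    ∏ c : K, (X - C c) = (X ^ Fintype.card K - X : K[X]) := by
  have hm : (X ^ Fintype.card K - X : K[X]).Monic :=
    monic_X_pow_sub (by simpa using Fintype.one_lt_card)
  have hr := FiniteField.roots_X_pow_card_sub_X K
  have := prod_multiset_X_sub_C_of_monic_of_roots_card_eq hm (by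
    rw [hr, FiniteField.X_pow_card_sub_X_natDegree_eq K Fintype.one_lt_card]; rfl)
  rw [hr] at this
  exact this

/-- The homogeneous form of `∏ (X - c) = X ^ q - X`. -/
theorem prod_sub_smul_eq {F A : Type*} [Field F] [Fintype F] [CommRing A] [IsDomain A]
    [Algebra F A] (T S : A) :
    ∏ c : F, (T - c • S) = T ^ Fintype.card F - S ^ (Fintype.card F - 1) * T := by
  have hq : 1 < Fintype.card F := Fintype.one_lt_card
  by_cases hS : S = 0
  · subst hS
    simp [Finset.card_univ, zero_pow (Nat.sub_ne_zero_of_lt hq)]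
  let K := FractionRing A
  apply IsFractionRing.injective A K
  have hS' : algebraMap A K S ≠ 0 := by
    rwa [Ne, map_eq_zero_iff _ (IsFractionRing.injective A K)]
  obtain ⟨t, ht⟩ : ∃ t : K, algebraMap A K T = algebraMap A K S * t :=
    ⟨algebraMap A K T / algebraMap A K S, (mul_div_cancel₀ _ hS').symm⟩
  have key := congrArg (fun P : F[X] => aeval t P) (prod_X_sub_C_eq_X_pow_card_sub_X F)
  simp only [map_prod, map_sub, aeval_X, aeval_C, map_pow] at key
  simp only [map_prod, map_sub, map_pow, map_mul, ht]
  have h1 : ∀ c : F, algebraMap A K S * t - algebraMap A K (c • S)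
      = algebraMap A K S * (t - algebraMap F K c) := by
    intro c
    rw [Algebra.smul_def, map_mul, ← IsScalarTower.algebraMap_apply F A K]
    ring
  simp only [h1, Finset.prod_mul_distrib, key, Finset.prod_const, Finset.card_univ]
  obtain ⟨k, hk⟩ : ∃ k, Fintype.card F = k + 1 := ⟨_, (Nat.sub_add_cancel hq.le).symm⟩
  rw [hk, Nat.add_sub_cancel]
  ring

/-- Powers of the Frobenius are `F`-linear, so a `q`-polynomial is additive and commutes with
scalars from `F`. -/
theorem qPolynomial_comp_sub_smul {F A : Type*} [Field F] [Fintype F] [CommRing A]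
    [Algebra F A] (m : ℕ) (c : ℕ → A) (a : F) (s : A) :
    (qPolynomial (Fintype.card F) m c).comp (X - C (a • s)) =
      qPolynomial (Fintype.card F) m c -
        a • C ((qPolynomial (Fintype.card F) m c).eval s) := by
  have h : ∀ (j : ℕ) (x : A[X]),
      x ^ (Fintype.card F ^ j) = (FiniteField.frobeniusAlgHom F A[X] ^ j) x := by
    intro j x
    rw [AlgHom.coe_pow, FiniteField.coe_frobeniusAlgHom, pow_iterate]
  rw [eval_qPolynomial]
  simp only [qPolynomial, Polynomial.sum_comp, mul_comp, C_comp, X_pow_comp, map_sum, map_mul,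
    C_pow, Finset.smul_sum, ← Finset.sum_sub_distrib]
  refine Finset.sum_congr rfl fun j _ => ?_
  rw [h, h, h, ← smul_C, map_sub, map_smul, mul_sub, mul_smul_comm]

theorem qPolynomial_pow_card {F A : Type*} [Field F] [Fintype F] [CommRing A]
    [Algebra F A] (m w : ℕ) (c : ℕ → A) :
    qPolynomial (Fintype.card F) m c ^ (Fintype.card F ^ w) =
      ∑ j ∈ Finset.range (m + 1),
        C (c j ^ (Fintype.card F ^ w)) * X ^ (Fintype.card F ^ (j + w)) := by
  have h : ∀ (x : A[X]),
      x ^ (Fintype.card F ^ w) = (FiniteField.frobeniusAlgHom F A[X] ^ w) x := by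
    intro x
    rw [AlgHom.coe_pow, FiniteField.coe_frobeniusAlgHom, pow_iterate]
  rw [h, qPolynomial, map_sum]
  refine Finset.sum_congr rfl fun j _ => ?_
  rw [← h, mul_pow, C_pow, ← pow_mul, pow_add]

/-- A finite product of linear factors over a tuple of coefficients is a `q`-polynomial. -/
theorem exists_prod_pi_eq_qPolynomial {F A : Type*} [Field F] [Fintype F] [CommRing A] [IsDomain A]
    [Algebra F A] (n : ℕ) (v : Fin n → A) :
    ∃ c : ℕ → A, c n = 1 ∧
      ∏ a : Fin n → F, (X - C (∑ i, a i • v i)) = qPolynomial (Fintype.card F) n c := by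
  induction n with
  | zero => exact ⟨fun _ => 1, rfl, by simp [qPolynomial]⟩
  | succ n ih =>
    obtain ⟨c, hc, hprod⟩ := ih fun i => v i.succ
    set q := Fintype.card F with hqd
    set P := qPolynomial q n c with hP
    set S := P.eval (v 0) with hS
    -- Translation by `a • v 0` changes the additive polynomial `P` only by the constant `a • S`.
    -- The product over `a` is then `P ^ q - S ^ (q - 1) * P`.
    have h1 : ∏ a : Fin (n + 1) → F, (X - C (∑ i, a i • v i)) =
        ∏ a : F, (P - a • C S) := by
      rw [← (Fin.consEquiv fun _ : Fin (n + 1) => F).prod_comp, Fintype.prod_prod_type]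
      refine Finset.prod_congr rfl fun a _ => ?_
      rw [hS, ← qPolynomial_comp_sub_smul, ← hqd, ← hP, ← hprod, prod_comp]
      refine Finset.prod_congr rfl fun b _ => ?_
      simp [Fin.sum_univ_succ, Fin.consEquiv, sub_sub]
    -- The coefficients of `P ^ q - S ^ (q - 1) * P`. The case distinctions discard `c` at the
    -- truncated index `0 - 1` and at indices above `n`, where it is unspecified.
    refine ⟨fun j => (if j = 0 then 0 else c (j - 1) ^ q) - S ^ (q - 1) *
      (if j ≤ n then c j else 0), by simp [hc], ?_⟩
    rw [h1, prod_sub_smul_eq, ← hqd]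
    have h2 := qPolynomial_pow_card (F := F) n 1 c
    rw [← hqd, pow_one, ← hP] at h2
    rw [h2, qPolynomial]
    simp only [map_sub, sub_mul, Finset.sum_sub_distrib]
    congr 1
    · rw [Finset.sum_range_succ' _ (n + 1)]
      simp
    · rw [Finset.sum_range_succ _ (n + 1), hP, qPolynomial, Finset.mul_sum]
      simp only [Nat.not_succ_le_self, if_false, mul_zero, map_zero, zero_mul, add_zero]
      refine Finset.sum_congr rfl fun j hj => ?_
      rw [if_pos (Nat.lt_succ_iff.1 (Finset.mem_range.1 hj))]
      simp [mul_assoc]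

theorem exists_prod_eq_qPolynomial {F A M : Type*} [Field F] [Fintype F] [CommRing A] [IsDomain A]
    [Algebra F A] [AddCommGroup M] [Module F M] [Fintype M] (φ : M →ₗ[F] A) {m : ℕ}
    (hm : Module.finrank F M = m) :
    ∃ c : ℕ → A, c m = 1 ∧ ∏ z : M, (X - C (φ z)) = qPolynomial (Fintype.card F) m c := by
  have : Module.Finite F M := Module.Finite.of_finite
  let b := Module.finBasisOfFinrankEq F M hm
  obtain ⟨c, hc, h⟩ := exists_prod_pi_eq_qPolynomial (F := F) m fun i => φ (b i)
  refine ⟨c, hc, ?_⟩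
  rw [← h, ← b.equivFun.toEquiv.symm.prod_comp]
  refine Finset.prod_congr rfl fun a _ => ?_
  congr 2
  simp [Module.Basis.equivFun_symm_apply]

/-- Each factor has total degree at most one in the two variables, so the total degree of the
product is at most the number of factors. -/
theorem natDegree_coeff_prod_X_sub_C {ι R : Type*} [CommRing R] [IsDomain R] (s : Finset ι)
    (a : ι → R[X]) (ha : ∀ i, (a i).natDegree ≤ 1) (k : ℕ)
    (hk : (∏ i ∈ s, (X - C (a i))).coeff k ≠ 0) :
    ((∏ i ∈ s, (X - C (a i))).coeff k).natDegree + k ≤ s.card := by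
  classical
  induction s using Finset.induction_on generalizing k with
  | empty =>
    simp only [Finset.prod_empty, coeff_one] at hk ⊢
    split_ifs at hk ⊢ with h
    · simp [h]
    · simp at hk
  | insert i s hi ih =>
    rw [Finset.prod_insert hi] at hk ⊢
    rw [Finset.card_insert_of_notMem hi]
    set P := ∏ j ∈ s, (X - C (a j)) with hP
    have hmul : (a i * P.coeff k).natDegree + k ≤ s.card + 1 ∨ a i * P.coeff k = 0 := by
      by_cases h0 : P.coeff k = 0
      · right; rw [h0, mul_zero]
      · left
        have h1 := natDegree_mul_le (p := a i) (q := P.coeff k)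
        have h2 := ih k h0
        have h3 := ha i
        omega
    have hX : (X - C (a i)) * P = X * P - C (a i) * P := sub_mul _ _ _
    cases k with
    | zero =>
      rw [hX] at hk ⊢
      simp only [coeff_sub, mul_coeff_zero, coeff_X_zero, zero_mul, coeff_C_zero, zero_sub,
        natDegree_neg, neg_ne_zero] at hk ⊢
      exact hmul.resolve_right hk
    | succ k =>
      rw [hX] at hk ⊢
      simp only [coeff_sub, coeff_X_mul, coeff_C_mul] at hk ⊢
      have h4 : (P.coeff k).natDegree + k ≤ s.card ∨ P.coeff k = 0 := by
        by_cases h0 : P.coeff k = 0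
        · exact Or.inr h0
        · exact Or.inl (ih k h0)
      rcases h4 with h4 | h4
      · rcases hmul with h5 | h5
        · have := natDegree_sub_le (P.coeff k) (a i * P.coeff (k + 1))
          omega
        · rw [h5, sub_zero]; omega
      · rw [h4, zero_sub, natDegree_neg]
        rw [h4, zero_sub, neg_ne_zero] at hk
        exact hmul.resolve_right hk

end LinearizedPolynomials

/-! ### The Rédei polynomial of the graph of a linear map. -/

section RedeiPolynomial

open Polynomial

variable {F E : Type*} [Field F] [Field E] [Algebra F E]

/-- The map `z ↦ f z - y * z`. -/
noncomputable def slopeMap (f : E →ₗ[F] E) (y : E) : E →ₗ[F] E := f - LinearMap.mulLeft F y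

@[simp]
theorem slopeMap_apply (f : E →ₗ[F] E) (y z : E) : slopeMap f y z = f z - y * z := rfl

variable [Fintype E]

open Classical in
/-- The directions determined by the graph of `f`. -/
noncomputable def directions (f : E →ₗ[F] E) : Finset E :=
  Finset.univ.filter fun y => LinearMap.ker (slopeMap f y) ≠ ⊥

theorem mem_directions (f : E →ₗ[F] E) (y : E) :
    y ∈ directions f ↔ LinearMap.ker (slopeMap f y) ≠ ⊥ := by
  simp [directions]

theorem prod_X_sub_C_submodule_dvd (I : Submodule F E) [Fintype I] :
    ∏ i : I, (X - C (i : E)) ∣ X ^ Fintype.card E - X := by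
  classical
  rw [← prod_X_sub_C_eq_X_pow_card_sub_X E, ← Finset.prod_subtype
    (Finset.univ.filter fun x => x ∈ I) (by simp) (fun x : E => X - C x)]
  exact Finset.prod_dvd_prod_of_subset _ _ _ (Finset.subset_univ _)

variable [Fintype F]

/-- The coefficients of the Rédei polynomial of the graph of a linear map. -/
theorem exists_redei_coeffs (f : E →ₗ[F] E) {n : ℕ} (hn : Module.finrank F E = n) :
    ∃ c : ℕ → E[X],
      (∀ j, j ≤ n → c j ≠ 0 → (c j).natDegree + Fintype.card F ^ j ≤ Fintype.card F ^ n) ∧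
      c n = 1 ∧ ∀ y, ∏ z : E, (X - C (slopeMap f y z)) =
        qPolynomial (Fintype.card F) n fun j => (c j).eval y := by
  -- The slope becomes the variable of `E[X]`; evaluating at `y` recovers `slopeMap f y`.
  let φ : E →ₗ[F] E[X] := (CAlgHom (R := F) (A := E)).toLinearMap ∘ₗ f -
    LinearMap.mulLeft F X ∘ₗ (CAlgHom (R := F) (A := E)).toLinearMap
  have hφ : ∀ z, φ z = C (f z) - X * C z := fun z => rfl
  obtain ⟨c, hc, hprod⟩ := exists_prod_eq_qPolynomial φ hn
  refine ⟨c, fun j hj hcj => ?_, hc, fun y => ?_⟩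
  · have h1 := congrArg (fun P => P.coeff (Fintype.card F ^ j)) hprod
    simp only [coeff_qPolynomial Fintype.one_lt_card, if_pos hj] at h1
    rw [← h1] at hcj ⊢
    have := natDegree_coeff_prod_X_sub_C Finset.univ (fun z => φ z) (fun z => by
      rw [hφ]
      refine (natDegree_sub_le _ _).trans (max_le (by simp) ?_)
      exact (natDegree_mul_C_le _ _).trans natDegree_X_le) _ hcj
    rwa [Finset.card_univ, Module.card_eq_pow_finrank (K := F) (V := E), hn] at this
  · have := congrArg (Polynomial.map (evalRingHom y)) hprod
    rw [map_qPolynomial, Polynomial.map_prod] at this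
    rw [← coe_evalRingHom, ← this]
    refine Finset.prod_congr rfl fun z _ => ?_
    simp [hφ]
    exact mul_comm _ _

/-- Every fibre of `g` over its range is a coset of the kernel. -/
theorem prod_X_sub_C_linearMap_eq_pow (g : E →ₗ[F] E) [Fintype (LinearMap.range g)] :
    ∏ z : E, (X - C (g z)) = (∏ i : LinearMap.range g, (X - C (i : E))) ^
      (Fintype.card F ^ Module.finrank F (LinearMap.ker g)) := by
  classical
  refine (Fintype.prod_fiberwise' (fun z => g.rangeRestrict z)
    (fun i : LinearMap.range g => (X - C (i : E)))).symm.trans ?_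
  rw [← Finset.prod_pow]
  refine Finset.prod_congr rfl fun i _ => ?_
  rw [Finset.prod_const, Finset.card_univ, ← Module.card_eq_pow_finrank (K := F)]
  congr 1
  obtain ⟨z, hz⟩ := g.surjective_rangeRestrict i
  refine Fintype.card_congr ((Equiv.subRight z).subtypeEquiv fun x => ?_)
  rw [← hz]
  simp [LinearMap.rangeRestrict, sub_eq_zero, Subtype.ext_iff]

theorem eq_C_mul_of_monic_dvd {R : Type*} [CommRing R] [IsDomain R] {G H : R[X]} (hG : G.Monic)
    (h : G ∣ H) (hd : H.natDegree ≤ G.natDegree) : ∃ k : R, H = C k * G := by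
  obtain ⟨K, rfl⟩ := h
  by_cases hK : K = 0
  · exact ⟨0, by simp [hK]⟩
  · rw [natDegree_mul hG.ne_zero hK] at hd
    rw [eq_C_of_natDegree_eq_zero (p := K) (by omega)]
    exact ⟨K.coeff 0, mul_comm _ _⟩

/-- The shape of the specialisation of the Rédei polynomial at a direction. -/
theorem exists_range_coeffs (f : E →ₗ[F] E) {n m w : ℕ} (hn : Module.finrank F E = n) {y : E}
    (hw : Module.finrank F (LinearMap.ker (slopeMap f y)) = w)
    (hm : Module.finrank F (LinearMap.range (slopeMap f y)) = m) (hw0 : 0 < w) {a : ℕ → E}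
    (ha : ∏ z : E, (X - C (slopeMap f y z)) = qPolynomial (Fintype.card F) n a)
    (han : a n = 1) (ha0 : ∀ j, m < j → j < n → a j = 0) :
    ∃ (b : ℕ → E) (k : E), b m = 1 ∧
      (∀ x, x ∈ LinearMap.range (slopeMap f y) ↔
        ∑ j ∈ Finset.range (m + 1), b j * x ^ (Fintype.card F ^ j) = 0) ∧
      (∀ j, j ≤ m → a j = if w ≤ j then b (j - w) ^ (Fintype.card F ^ w) else 0) ∧
      ∀ j, j ≤ m → a j + (if j = 0 then 1 else 0) = k * b j := by
  classical
  set q := Fintype.card F with hqd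
  have hq : 1 < q := Fintype.one_lt_card
  have hmw : m + w = n := by
    rw [← hw, ← hm, ← hn]; exact LinearMap.finrank_range_add_finrank_ker _
  set I := LinearMap.range (slopeMap f y) with hI
  obtain ⟨b, hb, hG⟩ := exists_prod_eq_qPolynomial (I.subtype) hm
  simp only [Submodule.subtype_apply, ← hqd] at hG
  set G := ∏ i : I, (X - C (i : E)) with hGd
  have hGm : G.Monic := monic_prod_of_monic _ _ fun i _ => monic_X_sub_C _
  have hGdeg : G.natDegree = q ^ m := by
    rw [hGd, natDegree_prod_of_monic _ _ fun i _ => monic_X_sub_C _]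
    simp only [natDegree_X_sub_C, Finset.sum_const, Finset.card_univ, smul_eq_mul, mul_one]
    rw [Module.card_eq_pow_finrank (K := F), hm]
  have hR := prod_X_sub_C_linearMap_eq_pow (slopeMap f y)
  rw [ha, hw] at hR
  -- By the gap `ha0`, subtracting `X ^ (q ^ n) - X` from the Rédei polynomial at `y` leaves only
  -- exponents up to `q ^ m`. Both terms are divisible by `G`, which is monic of degree `q ^ m`, so
  -- the difference is a constant multiple of `G`.
  set H := qPolynomial q m fun j => a j + (if j = 0 then 1 else 0) with hH
  have hHR : H = (qPolynomial q n a) - (X ^ (q ^ n) - X) := by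
    have h1 : qPolynomial q n a = ∑ j ∈ Finset.range n, C (a j) * X ^ (q ^ j) + X ^ (q ^ n) := by
      rw [qPolynomial, Finset.sum_range_succ, han, map_one, one_mul]
    have h2 : ∑ j ∈ Finset.range n, C (a j) * X ^ (q ^ j) =
        ∑ j ∈ Finset.range (m + 1), C (a j) * X ^ (q ^ j) := by
      symm
      refine Finset.sum_subset (Finset.range_subset_range.2 (by omega)) fun j hj hj' => ?_
      rw [ha0 j (by simpa using hj') (by simpa using hj), map_zero, zero_mul]
    have h3 : H = ∑ j ∈ Finset.range (m + 1), C (a j) * X ^ (q ^ j) + X := by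
      simp only [hH, qPolynomial, map_add, add_mul, Finset.sum_add_distrib]
      congr 1
      rw [Finset.sum_eq_single 0 (fun j _ hj => by simp [hj]) (by simp)]
      simp
    rw [h3, h1, h2]
    ring
  have hGH : G ∣ H := by
    rw [hHR]
    refine dvd_sub ?_ ?_
    · rw [hR]; exact dvd_pow_self _ (pow_ne_zero _ (by omega))
    · rw [hqd, ← hn, ← Module.card_eq_pow_finrank (K := F) (V := E)]
      exact prod_X_sub_C_submodule_dvd I
  obtain ⟨k, hk⟩ := eq_C_mul_of_monic_dvd hGm hGH (by
    rw [hGdeg, hH, qPolynomial]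
    refine natDegree_sum_le_of_forall_le _ _ fun j hj => ?_
    exact (natDegree_C_mul_X_pow_le _ _).trans
      (Nat.pow_le_pow_right hq.le (Nat.lt_succ_iff.1 (Finset.mem_range.1 hj))))
  refine ⟨b, k, hb, fun x => ?_, fun j hj => ?_, fun j hj => ?_⟩
  · rw [← eval_qPolynomial, ← hG, hGd, eval_prod, Finset.prod_eq_zero_iff]
    simp only [Finset.mem_univ, eval_sub, eval_X, eval_C, true_and, sub_eq_zero]
    exact ⟨fun h => ⟨⟨x, h⟩, rfl⟩, fun ⟨i, hi⟩ => hi ▸ i.2⟩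
  · have h1 := congrArg (fun P => P.coeff (q ^ j)) hR
    simp only [coeff_qPolynomial hq, if_pos (show j ≤ n by omega)] at h1
    rw [h1, ← hGd, hG, qPolynomial_pow_card]
    simp only [finsetSum_coeff, coeff_C_mul, coeff_X_pow, ← hqd,
      (Nat.pow_right_injective hq).eq_iff, mul_ite, mul_one, mul_zero]
    split_ifs with hwj
    · rw [Finset.sum_eq_single (j - w)]
      · rw [if_pos (by omega)]
      · intro i _ hi
        rw [if_neg (by omega)]
      · intro h
        exact absurd (Finset.mem_range.2 (by omega)) h
    · exact Finset.sum_eq_zero fun i _ => if_neg (by omega)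
  · have h1 := congrArg (fun P => P.coeff (q ^ j)) hk
    simpa only [hH, hG, coeff_C_mul, coeff_qPolynomial hq, if_pos hj] using h1

/-- At a slope that is not a direction `slopeMap f y` is bijective, so the Rédei polynomial there is
`X ^ (q ^ n) - X` and `c j` vanishes. With fewer than `q ^ j` directions this is more roots than the
degree bound `q ^ n - q ^ j` allows. -/
theorem redei_coeff_eq_zero (f : E →ₗ[F] E) {n : ℕ} (hn : Module.finrank F E = n) {c : ℕ → E[X]}
    (hdeg : ∀ j, j ≤ n → c j ≠ 0 → (c j).natDegree + Fintype.card F ^ j ≤ Fintype.card F ^ n)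
    (hc : ∀ y, ∏ z : E, (X - C (slopeMap f y z)) =
        qPolynomial (Fintype.card F) n fun j => (c j).eval y)
    {j : ℕ} (hj0 : 0 < j) (hjn : j < n) (hD : (directions f).card < Fintype.card F ^ j) :
    c j = 0 := by
  classical
  have hq : 1 < Fintype.card F := Fintype.one_lt_card
  by_contra h
  have h1 := hdeg j hjn.le h
  have h2 : (directions f)ᶜ ⊆ (c j).roots.toFinset := by
    intro y hy
    rw [Finset.mem_compl, mem_directions, not_not] at hy
    rw [Multiset.mem_toFinset, mem_roots h, IsRoot.def]
    have hb : Function.Bijective (slopeMap f y) := by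
      exact Finite.injective_iff_bijective.1 (LinearMap.ker_eq_bot.1 hy)
    have h3 := hc y
    rw [hb.prod_comp (fun z : E => X - C z), prod_X_sub_C_eq_X_pow_card_sub_X,
      Module.card_eq_pow_finrank (K := F) (V := E), hn] at h3
    have h4 := congrArg (fun P => P.coeff (Fintype.card F ^ j)) h3
    simp only [coeff_qPolynomial hq, if_pos hjn.le, coeff_sub, coeff_X_pow,
      (Nat.pow_right_injective hq).eq_iff, if_neg hjn.ne, coeff_X] at h4
    rw [← h4, if_neg (Nat.one_lt_pow hj0.ne' hq).ne, sub_zero]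
  have h3 := (Finset.card_le_card h2).trans (Multiset.toFinset_card_le _)
  rw [Finset.card_compl, Module.card_eq_pow_finrank (K := F) (V := E), hn] at h3
  have h4 := card_roots' (c j)
  omega

/-- A direction of weight `w` forces at least `q ^ (n - w)` directions. -/
theorem pow_le_card_directions (f : E →ₗ[F] E) {n m : ℕ} (hn : Module.finrank F E = n) {y : E}
    (hy : y ∈ directions f)
    (hm : Module.finrank F (LinearMap.range (slopeMap f y)) = m) :
    Fintype.card F ^ m ≤ (directions f).card := by
  have hq : 1 < Fintype.card F := Fintype.one_lt_card
  by_contra! hlt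
  obtain ⟨c, hdeg, hcn, hc⟩ := exists_redei_coeffs f hn
  have hw0 : 0 < Module.finrank F (LinearMap.ker (slopeMap f y)) := by
    rw [Module.finrank_pos_iff, Submodule.nontrivial_iff_ne_bot]
    exact (mem_directions f y).1 hy
  have hmw := LinearMap.finrank_range_add_finrank_ker (slopeMap f y)
  have hm0 : 0 < m := by
    rcases Nat.eq_zero_or_pos m with h | h
    · rw [h, pow_zero, Nat.lt_one_iff, Finset.card_eq_zero] at hlt
      simp [hlt] at hy
    · exact h
  have hz : ∀ j, m ≤ j → j < n → c j = 0 := fun j hj hjn =>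
    redei_coeff_eq_zero f hn hdeg hc (by omega) hjn
      (hlt.trans_le (Nat.pow_le_pow_right hq.le hj))
  obtain ⟨b, k, hb, -, h1, h2⟩ := exists_range_coeffs f hn rfl hm hw0 (hc y) (by simp [hcn])
    fun j hj hjn => by simp [hz j hj.le hjn]
  -- The coefficients at `X ^ (q ^ m)` are compared: the Rédei coefficient vanishes, while `b m =
  -- 1`.
  have hk : k = 0 := by
    have := h2 m le_rfl
    rw [hz m le_rfl (by omega), hb, if_neg hm0.ne'] at this
    simpa using this.symm
  -- At `X` itself the left side is `1`, since a `q ^ w`-th power with `w > 0` has no linear term;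
  -- this contradicts `k = 0`.
  have h3 := h2 0 hm0.le
  rw [h1 0 hm0.le, if_neg (by omega), hk] at h3
  simp at h3

/-- If there are few directions, then the range of `z ↦ f z - y * z` at a direction of weight `d`
is linear over the field with `q ^ d` elements. -/
theorem range_slopeMap_closed (f : E →ₗ[F] E) {n d : ℕ} (hn : Module.finrank F E = n) {y : E}
    (hd : Module.finrank F (LinearMap.ker (slopeMap f y)) = d) (hd0 : 0 < d)
    (hlt : (directions f).card < Fintype.card F ^ (n - d + 1)) :
    d ∣ n ∧ ∀ a : E, a ^ (Fintype.card F ^ d) = a → ∀ x ∈ LinearMap.range (slopeMap f y),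
      a * x ∈ LinearMap.range (slopeMap f y) := by
  have hq : 1 < Fintype.card F := Fintype.one_lt_card
  obtain ⟨c, hdeg, hcn, hc⟩ := exists_redei_coeffs f hn
  have hmw := LinearMap.finrank_range_add_finrank_ker (slopeMap f y)
  rw [hd, hn] at hmw
  obtain ⟨m, hm⟩ : ∃ m, Module.finrank F (LinearMap.range (slopeMap f y)) = m := ⟨_, rfl⟩
  rw [hm] at hmw
  rw [show n - d = m by omega] at hlt
  obtain ⟨b, k, hb, hroot, h1, h2⟩ := exists_range_coeffs f hn hd hm hd0 (hc y) (by simp [hcn])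
    fun j hj hjn => by
      rw [redei_coeff_eq_zero f hn hdeg hc (by omega) hjn
        (hlt.trans_le (Nat.pow_le_pow_right hq.le hj)), eval_zero]
  have h0 := h2 0 (Nat.zero_le _)
  rw [h1 0 (Nat.zero_le _), if_neg (by omega), if_pos rfl, zero_add] at h0
  have hk : k ≠ 0 := left_ne_zero_of_mul (h0 ▸ one_ne_zero)
  -- For `j > 0` the two descriptions of the Rédei coefficients give `k * b j = b (j - d) ^ (q ^ d)`
  -- if `d ≤ j` and `k * b j = 0` otherwise, starting from `b 0 ≠ 0`.
  have hsupp : ∀ j, j ≤ m → (b j ≠ 0 ↔ d ∣ j) := by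
    intro j
    induction j using Nat.strong_induction_on with
    | _ j ih =>
      intro hj
      rcases Nat.eq_zero_or_pos j with rfl | hj0
      · simpa using right_ne_zero_of_mul (h0 ▸ one_ne_zero)
      have h3 := h2 j hj
      rw [h1 j hj, if_neg hj0.ne', add_zero] at h3
      by_cases hdj : d ≤ j
      · rw [if_pos hdj] at h3
        rw [← Nat.dvd_sub_iff_left hdj dvd_rfl, ← ih (j - d) (by omega) (by omega)]
        rw [← pow_ne_zero_iff (a := b (j - d)) (pow_ne_zero d (zero_lt_one.trans hq).ne'), h3,
          mul_ne_zero_iff, and_iff_right hk]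
      · rw [if_neg hdj] at h3
        have : b j = 0 := (mul_eq_zero.1 h3.symm).resolve_left hk
        simp only [this, ne_eq, not_true_eq_false, false_iff]
        exact fun h => hdj (Nat.le_of_dvd hj0 h)
  have hdm : d ∣ m := (hsupp m le_rfl).1 (hb ▸ one_ne_zero)
  refine ⟨hmw ▸ hdm.add dvd_rfl, fun a ha x hx => ?_⟩
  rw [hroot] at hx ⊢
  have hpow : ∀ i, a ^ (Fintype.card F ^ (d * i)) = a := by
    intro i
    induction i with
    | zero => simp
    | succ i ih => rw [Nat.mul_succ, pow_add, pow_mul, ih, ha]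
  -- Only exponents `q ^ (d * i)` occur, so the polynomial cutting out the range commutes with
  -- multiplication by `a`.
  rw [← mul_zero a, ← hx, Finset.mul_sum]
  refine Finset.sum_congr rfl fun j hj => ?_
  by_cases hbj : b j = 0
  · simp [hbj]
  · obtain ⟨i, rfl⟩ := (hsupp j (Nat.lt_succ_iff.1 (Finset.mem_range.1 hj))).1 hbj
    rw [mul_pow, hpow]
    ring

end RedeiPolynomial

/-! ### Weights of points and counts of vectors. -/

section Weights

variable {E W : Type*} [Field E] [AddCommGroup W] [Module E W] {F : Subfield E}

/-- The vectors of `U` lying on the point `P`. -/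
def slice (U : Submodule F W) (P : ℙ E W) : Submodule F W := U ⊓ P.submodule.restrictScalars F

theorem mem_slice_mk {U : Submodule F W} {w : W} (hw : w ≠ 0) {x : W} :
    x ∈ slice U (Projectivization.mk E w hw) ↔ x ∈ U ∧ ∃ a : E, a • w = x := by
  simp [slice, Submodule.mem_span_singleton]

theorem mem_submodule_iff_mk_eq {x : W} (hx : x ≠ 0) (P : ℙ E W) :
    x ∈ P.submodule ↔ Projectivization.mk E x hx = P := by
  induction P using Projectivization.ind with
  | h v hv =>
    rw [Projectivization.submodule_mk, Submodule.mem_span_singleton,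
      Projectivization.mk_eq_mk_iff']

theorem mem_linearSet_iff_slice_ne_bot (U : Submodule F W) (P : ℙ E W) :
    P ∈ linearSet U ↔ slice U P ≠ ⊥ := by
  rw [Submodule.ne_bot_iff]
  constructor
  · rintro ⟨u, hu, huU, h⟩
    exact ⟨u, ⟨huU, (mem_submodule_iff_mk_eq hu P).2 h⟩, hu⟩
  · rintro ⟨u, ⟨huU, h⟩, hu⟩
    exact ⟨u, hu, huU, (mem_submodule_iff_mk_eq hu P).1 h⟩

theorem natCard_ne_zero_add_one (U : Submodule F W) [Finite U] :
    Nat.card {x : U // x ≠ 0} + 1 = Nat.card U := by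
  have := Fintype.ofFinite U
  classical
  rw [Nat.card_eq_fintype_card, Nat.card_eq_fintype_card, Fintype.card_subtype_compl,
    Fintype.card_subtype_eq]
  have : 0 < Fintype.card U := Fintype.card_pos
  omega

/-- The points partition the non-zero vectors of `U`. -/
theorem sum_natCard_slice [Finite W] [Fintype (ℙ E W)] (U : Submodule F W) :
    ∑ P : ℙ E W, (Nat.card (slice U P) - 1) + 1 = Nat.card U := by
  rw [← natCard_ne_zero_add_one U]
  congr 1
  let g : {x : U // x ≠ 0} → ℙ E W := fun x =>
    Projectivization.mk E (x.1 : W) (fun h => x.2 (Subtype.ext h))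
  rw [← Nat.card_congr (Equiv.sigmaFiberEquiv g), Nat.card_sigma]
  refine Finset.sum_congr rfl fun P _ => ?_
  rw [← natCard_ne_zero_add_one (slice U P), Nat.add_sub_cancel]
  refine Nat.card_congr ?_
  exact
    { toFun := fun x => ⟨⟨⟨x.1.1, x.1.2.1⟩, fun h => x.2 (Subtype.ext (Subtype.ext_iff.1 h :))⟩,
        (mem_submodule_iff_mk_eq (fun h => x.2 (Subtype.ext h)) P).1 x.1.2.2⟩
      invFun := fun x => ⟨⟨x.1.1.1, x.1.1.2, (mem_submodule_iff_mk_eq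
        (fun h => x.1.2 (Subtype.ext h)) P).2 x.2⟩,
        fun h => x.1.2 (Subtype.ext (Subtype.ext_iff.1 h :))⟩
      left_inv := fun x => rfl
      right_inv := fun x => rfl }

theorem ncard_linearSet_mul_lt [Finite W] (U : Submodule F W) (k : ℕ)
    (hk : ∀ P ∈ linearSet U, k < Nat.card (slice U P)) :
    (linearSet U).ncard * k < Nat.card U := by
  classical
  have : Finite (ℙ E W) := inferInstance
  have := Fintype.ofFinite (ℙ E W)
  rw [← sum_natCard_slice U, Nat.lt_succ_iff, ← smul_eq_mul, Set.ncard_eq_toFinset_card',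
    ← Finset.sum_const]
  refine (Finset.sum_le_sum fun P hP => ?_).trans
    (Finset.sum_le_sum_of_subset (Finset.subset_univ _))
  exact Nat.le_sub_one_of_lt (hk P (Set.mem_toFinset.1 hP))

variable [Finite W]

theorem natCard_submodule_eq_pow (U : Submodule F W) :
    Nat.card U = Nat.card F ^ Module.finrank F U := Module.natCard_eq_pow_finrank

theorem finrank_slice_pos_iff (U : Submodule F W) (P : ℙ E W) :
    0 < Module.finrank F (slice U P) ↔ P ∈ linearSet U := by
  rw [mem_linearSet_iff_slice_ne_bot, Module.finrank_pos_iff, Submodule.nontrivial_iff_ne_bot]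

variable [Finite E]

theorem one_lt_natCard_subfield (F : Subfield E) : 1 < Nat.card F := Finite.one_lt_card

theorem natCard_eq_pow_finrank_subfield (F : Subfield E) :
    Nat.card E = Nat.card F ^ Module.finrank F E := Module.natCard_eq_pow_finrank

theorem finrank_restrictScalars_subfield (D : Submodule E W) :
    @Module.finrank F ↥(D.restrictScalars F) _ _ (Submodule.module _) =
      Module.finrank F E * Module.finrank E D :=
  (Module.finrank_mul_finrank F E D).symm

theorem finrank_subfield_eq_mul (F : Subfield E) (W : Type*) [AddCommGroup W] [Module E W]
    [Finite W] : Module.finrank F W = Module.finrank F E * Module.finrank E W :=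
  (Module.finrank_mul_finrank F E W).symm

theorem finrank_le_finrank_slice (hW : Module.finrank E W = 2) (U : Submodule F W) (P : ℙ E W) :
    Module.finrank F U ≤ Module.finrank F E + Module.finrank F (slice U P) := by
  have h1 := Submodule.finrank_sup_add_finrank_inf_eq U (P.submodule.restrictScalars F)
  have h2 := Submodule.finrank_le (U ⊔ P.submodule.restrictScalars F)
  rw [finrank_subfield_eq_mul F W, hW] at h2
  rw [finrank_restrictScalars_subfield, P.finrank_submodule] at h1
  rw [slice]
  omega

theorem linearSet_eq_univ_of_lt (hW : Module.finrank E W = 2) (U : Submodule F W)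
    (h : Module.finrank F E < Module.finrank F U) : linearSet U = Set.univ := by
  refine Set.eq_univ_of_forall fun P => ?_
  rw [← finrank_slice_pos_iff]
  have := finrank_le_finrank_slice hW U P
  omega

theorem ncard_linearSet_mul_sub_one_lt (U : Submodule F W) (d : ℕ)
    (hd : ∀ P ∈ linearSet U, d ≤ Module.finrank F (slice U P)) :
    (linearSet U).ncard * (Nat.card F ^ d - 1) < Nat.card F ^ Module.finrank F U := by
  have hq := one_lt_natCard_subfield F
  rw [← natCard_submodule_eq_pow]
  refine ncard_linearSet_mul_lt U _ fun P hP => ?_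
  rw [natCard_submodule_eq_pow]
  have h1 := Nat.pow_le_pow_right hq.le (hd P hP)
  have h2 : 0 < Nat.card F ^ d := pow_pos (by omega) d
  omega

theorem ncard_linearSet_lt (U : Submodule F W) :
    (linearSet U).ncard < Nat.card F ^ Module.finrank F U := by
  have hq := one_lt_natCard_subfield F
  have h := ncard_linearSet_mul_sub_one_lt U 1 fun P hP => (finrank_slice_pos_iff U P).2 hP
  rw [pow_one] at h
  exact (Nat.le_mul_of_pos_right _ (by omega)).trans_lt h

/-- Fewer than `q ^ n` points cannot fill a line with `q ^ n + 1` points. -/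
theorem linearSet_ne_univ_of_le (hW : Module.finrank E W = 2) (U : Submodule F W)
    (h : Module.finrank F U ≤ Module.finrank F E) : linearSet U ≠ Set.univ := by
  intro hU
  have h1 := ncard_linearSet_lt U
  have h2 := Nat.pow_le_pow_right (one_lt_natCard_subfield F).le h
  rw [hU, Set.ncard_univ, Projectivization.card_of_finrank_two E W hW] at h1
  rw [← natCard_eq_pow_finrank_subfield] at h2
  omega

end Weights

/-! ### Subspaces of rank `n` as graphs. -/

section Coordinates

variable {E W : Type*} [Field E] [AddCommGroup W] [Module E W] {F : Subfield E}

theorem exists_basis_pair (hW : Module.finrank E W = 2) {v w : W} (hv : v ≠ 0)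
    (hw : w ∉ Submodule.span E {v}) : ∃ b : Module.Basis (Fin 2) E W, b 0 = v ∧ b 1 = w := by
  have hli : LinearIndependent E ![v, w] := by
    rw [LinearIndependent.pair_iff' hv]
    intro a h
    exact hw (Submodule.mem_span_singleton.2 ⟨a, h⟩)
  refine ⟨basisOfLinearIndependentOfCardEqFinrank hli (by simp [hW]), ?_, ?_⟩ <;> simp

theorem exists_basis_fst (hW : Module.finrank E W = 2) {v : W} (hv : v ≠ 0) :
    ∃ b : Module.Basis (Fin 2) E W, b 0 = v := by
  obtain ⟨w, hw⟩ : ∃ w, w ∉ Submodule.span E {v} := by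
    by_contra! h
    have h1 : Submodule.span E {v} = ⊤ := eq_top_iff.2 fun w _ => h w
    have h2 := finrank_span_singleton (K := E) hv
    rw [h1, finrank_top, hW] at h2
    omega
  obtain ⟨b, hb, -⟩ := exists_basis_pair hW hv hw
  exact ⟨b, hb⟩

/-- A rank `n` subspace whose linear set misses a point is the graph of a linear map. -/
theorem exists_graph [Finite E] [Finite W] (U : Submodule F W)
    (hU : Module.finrank F U = Module.finrank F E) (b : Module.Basis (Fin 2) E W)
    (hb : Projectivization.mk E (b 0) (b.ne_zero 0) ∉ linearSet U) :
    ∃ f : E →ₗ[F] E, ∀ w, w ∈ U ↔ b.coord 0 w = f (b.coord 1 w) := by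
  let α : U →ₗ[F] E := ((b.coord 1).restrictScalars F) ∘ₗ U.subtype
  have hα : ∀ u : U, α u = b.coord 1 u := fun u => rfl
  have hsum : ∀ w, w = b.coord 0 w • b 0 + b.coord 1 w • b 1 := fun w => by
    conv_lhs => rw [← b.sum_repr w, Fin.sum_univ_two]
    rfl
  -- A non-zero vector of `U` killed by the second coordinate would lie on the excluded point `⟨b
  -- 0⟩`.
  have hinj : Function.Injective α := by
    rw [injective_iff_map_eq_zero]
    intro u hu
    by_contra hu0
    have hu0' : (u : W) ≠ 0 := fun h => hu0 (Subtype.ext h)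
    refine hb ⟨u, hu0', u.2, ?_⟩
    rw [Projectivization.mk_eq_mk_iff']
    refine ⟨b.coord 0 u, ?_⟩
    conv_rhs => rw [hsum u, ← hα, hu, zero_smul, add_zero]
  let e := LinearMap.linearEquivOfInjective α hinj hU
  have he : ∀ u, e u = α u := fun u => rfl
  refine ⟨(b.coord 0).restrictScalars F ∘ₗ U.subtype ∘ₗ e.symm.toLinearMap, fun w => ?_⟩
  have hf : ∀ x, ((b.coord 0).restrictScalars F ∘ₗ U.subtype ∘ₗ e.symm.toLinearMap) x =
    b.coord 0 (e.symm x) := fun x => rfl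
  rw [hf]
  constructor
  · intro hw
    have : b.coord 1 w = e ⟨w, hw⟩ := rfl
    rw [this, e.symm_apply_apply]
  · intro h
    have h1 : b.coord 1 (e.symm (b.coord 1 w) : U) = b.coord 1 w := by
      rw [← hα, ← he, e.apply_symm_apply]
    have : w = (e.symm (b.coord 1 w) : U) := by
      refine b.ext_elem fun i => ?_
      fin_cases i
      · exact h
      · exact h1.symm
    rw [this]
    exact (e.symm (b.coord 1 w)).2

end Coordinates

/-! ### From directions back to linear sets; closure under the field of order `q ^ d`. -/

section GraphCoordinates

variable {E W : Type*} [Field E] [AddCommGroup W] [Module E W] {F : Subfield E}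

theorem basis_line_ne_zero (b : Module.Basis (Fin 2) E W) (y : E) : b 1 + y • b 0 ≠ 0 := by
  intro h
  simpa using congrArg (b.coord 1) h

theorem exists_eq_mk_basis_line (b : Module.Basis (Fin 2) E W) {P : ℙ E W}
    (hP : P ≠ Projectivization.mk E (b 0) (b.ne_zero 0)) :
    ∃ y, P = Projectivization.mk E (b 1 + y • b 0) (basis_line_ne_zero b y) := by
  induction P using Projectivization.ind with
  | h w hw =>
    have hsum : w = b.coord 0 w • b 0 + b.coord 1 w • b 1 := by
      conv_lhs => rw [← b.sum_repr w, Fin.sum_univ_two]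
      rfl
    have h1 : b.coord 1 w ≠ 0 := by
      intro h
      refine hP ((Projectivization.mk_eq_mk_iff' ..).2 ⟨b.coord 0 w, ?_⟩)
      conv_rhs => rw [hsum, h, zero_smul, add_zero]
    refine ⟨b.coord 0 w / b.coord 1 w, (Projectivization.mk_eq_mk_iff' ..).2 ⟨b.coord 1 w, ?_⟩⟩
    conv_rhs => rw [hsum]
    rw [smul_add, smul_smul, mul_div_cancel₀ _ h1, add_comm]

theorem mk_basis_line_injective (b : Module.Basis (Fin 2) E W) :
    Function.Injective fun y =>
      Projectivization.mk E (b 1 + y • b 0) (basis_line_ne_zero b y) := by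
  intro y z h
  obtain ⟨a, ha⟩ := (Projectivization.mk_eq_mk_iff' ..).1 h
  have h1 := congrArg (b.coord 1) ha
  have h0 := congrArg (b.coord 0) ha
  simp only [map_smul, map_add, Module.Basis.coord_apply, Module.Basis.repr_self,
    Finsupp.single_apply, smul_eq_mul] at h0 h1
  norm_num at h0 h1
  rw [← h0, h1, one_mul]

theorem slice_eq_map_ker {U : Submodule F W} {b : Module.Basis (Fin 2) E W} {f : E →ₗ[F] E}
    (hf : ∀ w, w ∈ U ↔ b.coord 0 w = f (b.coord 1 w)) (y : E) :
    slice U (Projectivization.mk E (b 1 + y • b 0) (basis_line_ne_zero b y)) =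
      (LinearMap.ker (slopeMap f y)).map
        ((LinearMap.toSpanSingleton E W (b 1 + y • b 0)).restrictScalars F) := by
  have h : ∀ a : E, a • (b 1 + y • b 0) ∈ U ↔ f a - y * a = 0 := by
    intro a
    rw [hf, sub_eq_zero, eq_comm]
    simp [mul_comm]
  ext x
  rw [mem_slice_mk, Submodule.mem_map]
  constructor
  · rintro ⟨hx, a, rfl⟩
    exact ⟨a, (h a).1 hx, rfl⟩
  · rintro ⟨a, ha, rfl⟩
    exact ⟨(h a).2 ha, a, rfl⟩

theorem finrank_slice_eq_finrank_ker {U : Submodule F W} {b : Module.Basis (Fin 2) E W}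
    {f : E →ₗ[F] E} (hf : ∀ w, w ∈ U ↔ b.coord 0 w = f (b.coord 1 w)) (y : E) :
    Module.finrank F (slice U (Projectivization.mk E (b 1 + y • b 0) (basis_line_ne_zero b y))) =
      Module.finrank F (LinearMap.ker (slopeMap f y)) := by
  rw [slice_eq_map_ker hf]
  exact (Submodule.equivMapOfInjective _
    (smul_left_injective E (basis_line_ne_zero b y)) _).finrank_eq.symm

/-- The functional `x₀ - y * x₁` vanishes on the point and is `E`-linear, so closure of the range
under a scalar passes to `U + P`. -/
theorem mem_sup_iff_mem_range {U : Submodule F W} {b : Module.Basis (Fin 2) E W}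
    {f : E →ₗ[F] E} (hf : ∀ w, w ∈ U ↔ b.coord 0 w = f (b.coord 1 w)) (y : E) (w : W) :
    w ∈ U ⊔ (Projectivization.mk E (b 1 + y • b 0)
        (basis_line_ne_zero b y)).submodule.restrictScalars F ↔
      b.coord 0 w - y * b.coord 1 w ∈ LinearMap.range (slopeMap f y) := by
  rw [Submodule.mem_sup]
  constructor
  · rintro ⟨u, hu, p, hp, rfl⟩
    rw [Submodule.restrictScalars_mem, Projectivization.submodule_mk,
      Submodule.mem_span_singleton] at hp
    obtain ⟨a, rfl⟩ := hp
    refine ⟨b.coord 1 u, ?_⟩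
    rw [slopeMap_apply, ← (hf u).1 hu]
    simp
    ring
  · rintro ⟨z, hz⟩
    rw [slopeMap_apply] at hz
    refine ⟨z • b 1 + f z • b 0, (hf _).2 (by simp), (b.coord 1 w - z) • (b 1 + y • b 0), ?_, ?_⟩
    · rw [Submodule.restrictScalars_mem, Projectivization.submodule_mk,
        Submodule.mem_span_singleton]
      exact ⟨_, rfl⟩
    · refine b.ext_elem fun i => ?_
      fin_cases i
      · simp only [Module.Basis.coord_apply] at hz
        simp
        linear_combination hz
      · simp

variable [Finite W]

theorem mk_basis_line_mem_linearSet_iff [Fintype E]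
    {U : Submodule F W} {b : Module.Basis (Fin 2) E W}
    {f : E →ₗ[F] E} (hf : ∀ w, w ∈ U ↔ b.coord 0 w = f (b.coord 1 w)) (y : E) :
    Projectivization.mk E (b 1 + y • b 0) (basis_line_ne_zero b y) ∈ linearSet U ↔
      y ∈ directions f := by
  rw [← finrank_slice_pos_iff, finrank_slice_eq_finrank_ker hf, mem_directions,
    Module.finrank_pos_iff, Submodule.nontrivial_iff_ne_bot]

theorem ncard_linearSet_eq_card_directions [Fintype E]
    {U : Submodule F W} {b : Module.Basis (Fin 2) E W}
    {f : E →ₗ[F] E} (hf : ∀ w, w ∈ U ↔ b.coord 0 w = f (b.coord 1 w))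
    (hb : Projectivization.mk E (b 0) (b.ne_zero 0) ∉ linearSet U) :
    (linearSet U).ncard = (directions f).card := by
  rw [← Set.ncard_coe_finset, ← Set.ncard_image_of_injective _ (mk_basis_line_injective b)]
  congr 1
  ext P
  constructor
  · intro hP
    obtain ⟨y, rfl⟩ := exists_eq_mk_basis_line b fun h => hb (h ▸ hP)
    exact ⟨y, (mk_basis_line_mem_linearSet_iff hf y).1 hP, rfl⟩
  · rintro ⟨y, hy, rfl⟩
    exact (mk_basis_line_mem_linearSet_iff hf y).2 hy

variable [Finite E]

theorem exists_graph_coordinates (hW : Module.finrank E W = 2) (U : Submodule F W)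
    (hU : Module.finrank F U = Module.finrank F E) :
    ∃ (b : Module.Basis (Fin 2) E W) (f : E →ₗ[F] E),
      Projectivization.mk E (b 0) (b.ne_zero 0) ∉ linearSet U ∧
      ∀ w, w ∈ U ↔ b.coord 0 w = f (b.coord 1 w) := by
  obtain ⟨P, hP⟩ := (Set.ne_univ_iff_exists_notMem _).1 (linearSet_ne_univ_of_le hW U hU.le)
  obtain ⟨b, hb⟩ := exists_basis_fst hW P.rep_nonzero
  have hb' : Projectivization.mk E (b 0) (b.ne_zero 0) ∉ linearSet U := by
    simpa only [hb, P.mk_rep] using hP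
  obtain ⟨f, hf⟩ := exists_graph U hU b hb'
  exact ⟨b, f, hb', hf⟩

theorem pow_le_ncard_linearSet (hW : Module.finrank E W = 2) (U : Submodule F W)
    (hU : Module.finrank F U = Module.finrank F E) {P : ℙ E W} (hP : P ∈ linearSet U) :
    Nat.card F ^ (Module.finrank F E - Module.finrank F (slice U P)) ≤ (linearSet U).ncard := by
  have := Fintype.ofFinite E
  have := Fintype.ofFinite F
  obtain ⟨b, f, hb, hf⟩ := exists_graph_coordinates hW U hU
  obtain ⟨y, rfl⟩ := exists_eq_mk_basis_line b fun h => hb (h ▸ hP)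
  rw [ncard_linearSet_eq_card_directions hf hb, finrank_slice_eq_finrank_ker hf,
    Nat.card_eq_fintype_card]
  refine pow_le_card_directions f rfl ((mk_basis_line_mem_linearSet_iff hf y).1 hP) ?_
  have := LinearMap.finrank_range_add_finrank_ker (slopeMap f y)
  omega

theorem sup_closed_of_ncard_lt (hW : Module.finrank E W = 2) (U : Submodule F W)
    (hU : Module.finrank F U = Module.finrank F E) {P : ℙ E W} (hP : P ∈ linearSet U) {d : ℕ}
    (hd : Module.finrank F (slice U P) = d)
    (hlt : (linearSet U).ncard < Nat.card F ^ (Module.finrank F E - d + 1)) :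
    d ∣ Module.finrank F E ∧ ∀ a : E, a ^ (Nat.card F ^ d) = a →
      ∀ u ∈ U ⊔ P.submodule.restrictScalars F, a • u ∈ U ⊔ P.submodule.restrictScalars F := by
  have := Fintype.ofFinite E
  have := Fintype.ofFinite F
  have hd0 : 0 < d := hd ▸ (finrank_slice_pos_iff U P).2 hP
  obtain ⟨b, f, hb, hf⟩ := exists_graph_coordinates hW U hU
  obtain ⟨y, rfl⟩ := exists_eq_mk_basis_line b fun h => hb (h ▸ hP)
  rw [ncard_linearSet_eq_card_directions hf hb, Nat.card_eq_fintype_card] at hlt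
  rw [finrank_slice_eq_finrank_ker hf] at hd
  obtain ⟨h1, h2⟩ := range_slopeMap_closed f rfl hd hd0 hlt
  refine ⟨h1, fun a ha u hu => ?_⟩
  rw [Nat.card_eq_fintype_card] at ha
  rw [mem_sup_iff_mem_range hf] at hu ⊢
  have := h2 a ha _ hu
  simp only [map_smul, smul_eq_mul]
  convert this using 1
  ring

/-- A rank `n` subspace is linear over the field with `q ^ d` elements, where `d` is the least
weight of a point of its linear set. -/
theorem smul_mem_of_pow_eq (hW : Module.finrank E W = 2) (U : Submodule F W)
    (hU : Module.finrank F U = Module.finrank F E) {P : ℙ E W} (hP : P ∈ linearSet U) {d : ℕ}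
    (hd : Module.finrank F (slice U P) = d)
    (hmin : ∀ Q ∈ linearSet U, d ≤ Module.finrank F (slice U Q)) :
    d ∣ Module.finrank F E ∧ ∀ a : E, a ^ (Nat.card F ^ d) = a → ∀ u ∈ U, a • u ∈ U := by
  classical
  have hq := one_lt_natCard_subfield F
  have hd0 : 0 < d := hd ▸ (finrank_slice_pos_iff U P).2 hP
  set n := Module.finrank F E with hn
  set q := Nat.card F with hqd
  set N := (linearSet U).ncard with hN
  have hdn : d ≤ n := by
    rw [← hd, ← hU]
    exact Submodule.finrank_mono inf_le_left
  have hAN : q ^ (n - d) ≤ N := hd ▸ pow_le_ncard_linearSet hW U hU hP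
  have hAB : q ^ n = q ^ (n - d) * q ^ d := by rw [← pow_add, Nat.sub_add_cancel hdn]
  have hBq : q ≤ q ^ d := Nat.le_self_pow hd0.ne' q
  have hA : 0 < q ^ (n - d) := pow_pos (by omega) _
  -- Each point carries at least `q ^ d - 1` non-zero vectors of `U`, so `N * (q ^ d - 1) < q ^ n`,
  -- and `q * (q ^ d - 1) ≥ q ^ d`.
  have hlt : N < q ^ (n - d + 1) := by
    have h := ncard_linearSet_mul_sub_one_lt U d hmin
    rw [hU, ← hqd, ← hN, hAB] at h
    rw [pow_succ]
    by_contra! hge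
    have h1 := Nat.mul_le_mul_right (q ^ d - 1) hge
    obtain ⟨B, hB⟩ : ∃ B, q ^ d = B + 1 := ⟨q ^ d - 1, by omega⟩
    rw [hB, Nat.add_sub_cancel] at h1 h
    rw [hB] at hBq
    nlinarith [Nat.mul_le_mul_left (q ^ (n - d)) hBq, Nat.mul_le_mul_right B hA,
      Nat.mul_le_mul_right (q ^ (n - d) * B) hq]
  have hclosed : ∀ Q ∈ linearSet U, Module.finrank F (slice U Q) = d → d ∣ n ∧ ∀ a : E,
      a ^ (q ^ d) = a → ∀ u ∈ U ⊔ Q.submodule.restrictScalars F,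
        a • u ∈ U ⊔ Q.submodule.restrictScalars F :=
    fun Q hQ hQd => sup_closed_of_ncard_lt hW U hU hQ hQd hlt
  refine ⟨(hclosed P hP hd).1, fun a ha u hu => ?_⟩
  by_contra hv
  -- The enlarged space has rank `n + 1`, so it meets every point, and it gains weight on the points
  -- of `L_U` of weight `d`. The resulting number of vectors is too large.
  set T : Submodule F W := U ⊔ Submodule.span F {a • u} with hT
  have hTn : Module.finrank F T = n + 1 := by
    have h1 := Submodule.finrank_sup_add_finrank_inf_eq U (Submodule.span F {a • u})
    have hne : a • u ≠ 0 := fun h => hv (h ▸ U.zero_mem)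
    have h2 : U ⊓ Submodule.span F {a • u} = ⊥ := by
      rw [Submodule.eq_bot_iff]
      rintro x ⟨hx, hx'⟩
      obtain ⟨c, rfl⟩ := Submodule.mem_span_singleton.1 hx'
      by_cases hc : c = 0
      · rw [hc, zero_smul]
      · exact absurd ((U.smul_mem_iff hc).1 hx) hv
    rw [h2, finrank_bot, finrank_span_singleton hne, hU] at h1
    exact h1
  have hvT : a • u ∈ T := Submodule.mem_sup_right (Submodule.mem_span_singleton_self _)
  have hT1 : ∀ Q : ℙ E W, q ≤ Nat.card (slice T Q) := by
    intro Q
    rw [natCard_submodule_eq_pow]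
    have := finrank_le_finrank_slice hW T Q
    exact Nat.le_self_pow (by omega) q
  have hT2 : ∀ Q ∈ linearSet U, q ^ (d + 1) ≤ Nat.card (slice T Q) := by
    intro Q hQ
    rw [natCard_submodule_eq_pow]
    refine Nat.pow_le_pow_right hq.le ?_
    have hle : slice U Q ≤ slice T Q := inf_le_inf_right _ le_sup_left
    rcases (hmin Q hQ).lt_or_eq with h | h
    · exact h.trans_le (Submodule.finrank_mono hle)
    · rw [h, Nat.succ_le_iff]
      refine Submodule.finrank_lt_finrank_of_lt (lt_of_le_of_ne hle fun heq => ?_)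
      -- Since `U + Q` is closed under `a`, one has `a • u = u' + p` with `p` on `Q`. This `p` is in
      -- `T`, but not in `U`.
      obtain ⟨u', hu', p, hp, hup⟩ := Submodule.mem_sup.1
        ((hclosed Q hQ h.symm).2 a ha u (Submodule.mem_sup_left hu))
      have hpT : p ∈ slice T Q := by
        refine ⟨?_, hp⟩
        rw [← add_sub_cancel_left u' p, hup]
        exact T.sub_mem hvT (Submodule.mem_sup_left hu')
      rw [← heq] at hpT
      exact hv (hup ▸ U.add_mem hu' hpT.1)
  have : Finite (ℙ E W) := inferInstance
  have := Fintype.ofFinite (ℙ E W)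
  have hsum := sum_natCard_slice T
  rw [natCard_submodule_eq_pow, hTn] at hsum
  have hle : ∑ Q : ℙ E W, ((q - 1) + if Q ∈ linearSet U then q ^ (d + 1) - q else 0) ≤
      ∑ Q : ℙ E W, (Nat.card (slice T Q) - 1) := by
    refine Finset.sum_le_sum fun Q _ => ?_
    have h1 := hT1 Q
    split_ifs with h
    · have h2 := hT2 Q h
      omega
    · omega
  rw [Finset.sum_add_distrib, Finset.sum_const, Finset.card_univ, ← Finset.sum_filter,
    Finset.sum_const, ← Nat.card_eq_fintype_card, Projectivization.card_of_finrank_two E W hW,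
    natCard_eq_pow_finrank_subfield F, smul_eq_mul, smul_eq_mul] at hle
  have hcard : (Finset.univ.filter fun Q => Q ∈ linearSet U).card = N := by
    rw [hN, ← Set.ncard_coe_finset]
    simp
  rw [hcard, ← hqd, ← hn] at hle
  have h1 := Nat.mul_le_mul_right (q ^ (d + 1) - q) hAN
  -- This simplifies to `q ^ n * (q - 1) + q ≤ q ^ (n - d + 1)`, impossible for `d ≥ 1`.
  have h2 : (q ^ n + 1) * (q - 1) + q ^ (n - d) * (q ^ (d + 1) - q) + 1 ≤ q ^ (n + 1) := by
    rw [← hsum]; omega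
  rw [pow_succ q d, pow_succ q n, hAB] at h2
  obtain ⟨r, hr⟩ : ∃ r, q = r + 1 := ⟨q - 1, by omega⟩
  obtain ⟨s, hs⟩ : ∃ s, q ^ d = q + s := ⟨q ^ d - q, by omega⟩
  have h3 : q ^ d * q - q = q * (q ^ d - 1) := by rw [Nat.mul_sub, mul_one, mul_comm]
  rw [h3] at h2
  have h4 : q - 1 = r := by omega
  have h5 : q ^ d - 1 = r + s := by omega
  rw [h4, h5, hs, hr] at h2
  have hr0 : 0 < r := by omega
  generalize (r + 1) ^ (n - d) = A at h2
  have h6 : A * 1 ≤ A * (r * r) := Nat.mul_le_mul_left A (Nat.mul_pos hr0 hr0)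
  have h7 := Nat.zero_le (A * (r * s))
  ring_nf at h2 h6 h7
  omega

end GraphCoordinates

/-! ### All subspaces defining the linear set have rank `n`. -/

section RankUniqueness

variable {E W : Type*} [Field E] [AddCommGroup W] [Module E W] {F : Subfield E}

/-- The elements of `E` that map `U` into itself form a field. -/
def stabilizerSubfield [Finite E] (U : AddSubgroup W) : Subfield E where
  carrier := {a | ∀ u ∈ U, a • u ∈ U}
  mul_mem' := fun {a b} ha hb u hu => by
    rw [mul_smul]; exact ha _ (hb u hu)
  one_mem' := fun u hu => by rwa [one_smul]
  add_mem' := fun {a b} ha hb u hu => by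
    rw [add_smul]; exact U.add_mem (ha u hu) (hb u hu)
  zero_mem' := fun u _ => by rw [zero_smul]; exact U.zero_mem
  neg_mem' := fun {a} ha u hu => by
    rw [neg_smul]; exact U.neg_mem (ha u hu)
  inv_mem' := fun a ha => by
    -- In a finite field the inverse of a non-zero element is one of its powers.
    have hpow : ∀ k : ℕ, ∀ u ∈ U, a ^ k • u ∈ U := by
      intro k
      induction k with
      | zero => intro u hu; rwa [pow_zero, one_smul]
      | succ k ih => intro u hu; rw [pow_succ, mul_smul]; exact ih _ (ha u hu)
    by_cases h0 : a = 0
    · rw [h0, inv_zero]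
      intro u _
      rw [zero_smul]; exact U.zero_mem
    · have := Fintype.ofFinite E
      have hE : 1 < Fintype.card E := Fintype.one_lt_card
      have h1 := FiniteField.pow_card_sub_one_eq_one a h0
      have h2 : a⁻¹ = a ^ (Fintype.card E - 2) := by
        refine (eq_inv_of_mul_eq_one_left ?_).symm
        rw [← pow_succ, ← h1]
        congr 1
        omega
      rw [h2]
      exact hpow _

/-- The linear set is linear over the stabilizer of `U`, which contains `F`; maximality leaves no
room for a larger field. -/
theorem mem_of_smul_mem [Finite E] {U : Submodule F W}
    (hmax : IsMaxFieldOfLinearity F F (linearSet U)) {a : E} (ha : ∀ u ∈ U, a • u ∈ U) :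
    a ∈ F := by
  let S : Subfield E := stabilizerSubfield U.toAddSubgroup
  have hle : F ≤ S := fun c hc u hu => U.smul_mem ⟨c, hc⟩ hu
  let U' : Submodule S W :=
    { U.toAddSubgroup with
      smul_mem' := fun c u hu => c.2 u hu }
  have h1 : Nat.card S ≤ Nat.card F := hmax.2 S hle ⟨U', rfl⟩
  have h2 : (F : Set E) = S := Set.eq_of_subset_of_ncard_le hle h1
  have h3 : a ∈ (S : Set E) := ha
  rwa [← h2] at h3

/-- As `q ^ d - 1` divides the order of the cyclic group `Eˣ`, some unit has this order, which
exceeds `q - 1`. -/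
theorem exists_pow_eq_notMem [Finite E] (F : Subfield E) {d : ℕ} (hd : 1 < d)
    (hdn : d ∣ Module.finrank F E) : ∃ a : E, a ^ (Nat.card F ^ d) = a ∧ a ∉ F := by
  have hq := one_lt_natCard_subfield F
  set q := Nat.card F with hqd
  have hqd1 : q < q ^ d := by
    conv_lhs => rw [← pow_one q]
    exact Nat.pow_lt_pow_right hq hd
  obtain ⟨g, hg⟩ := IsCyclic.exists_ofOrder_eq_natCard (α := Eˣ)
  have hcard : Nat.card Eˣ = q ^ Module.finrank F E - 1 := by
    rw [Nat.card_units, natCard_eq_pow_finrank_subfield F]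
  have hdvd : q ^ d - 1 ∣ Nat.card Eˣ := hcard ▸ Nat.pow_sub_one_dvd_pow_sub_one q hdn
  obtain ⟨k, hk⟩ := hdvd
  have hk0 : k ≠ 0 := by
    rintro rfl
    exact Nat.card_pos.ne' hk
  have hord : orderOf (g ^ k) = q ^ d - 1 := by
    rw [orderOf_pow_of_dvd hk0 (by rw [hg, hk]; exact dvd_mul_left _ _), hg, hk,
      Nat.mul_div_cancel _ (Nat.pos_of_ne_zero hk0)]
  refine ⟨((g ^ k : Eˣ) : E), ?_, fun hF => ?_⟩
  · have h1 : (g ^ k) ^ (q ^ d - 1) = 1 := hord ▸ pow_orderOf_eq_one _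
    have h2 : (g ^ k) ^ (q ^ d) = g ^ k := by
      rw [← Nat.sub_add_cancel (show 1 ≤ q ^ d by omega), pow_succ, h1, one_mul]
    rw [← Units.val_pow_eq_pow_val, h2]
  · have := Fintype.ofFinite F
    have h1 : (⟨((g ^ k : Eˣ) : E), hF⟩ : F) ^ (Fintype.card F - 1) = 1 :=
      FiniteField.pow_card_sub_one_eq_one _ fun h =>
        (g ^ k).ne_zero (congrArg Subtype.val h)
    have h2 : (g ^ k) ^ (q - 1) = 1 := by
      rw [hqd, Nat.card_eq_fintype_card]
      ext
      exact congrArg Subtype.val h1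
    have h3 := Nat.le_of_dvd (by omega) (orderOf_dvd_of_pow_eq_one h2)
    omega

theorem finrank_subfield_pos [Finite E] (F : Subfield E) : 0 < Module.finrank F E :=
  Module.finrank_pos

/-- If the maximum field of linearity of a linear set of rank `n` is `F`, then every `F`-subspace
defining it has rank `n`. -/
theorem finrank_eq_of_linearSet_eq [Finite E] [Finite W] (hW : Module.finrank E W = 2)
    {U U' : Submodule F W} (hU : Module.finrank F U = Module.finrank F E)
    (hmax : IsMaxFieldOfLinearity F F (linearSet U)) (h : linearSet U' = linearSet U) :
    Module.finrank F U' = Module.finrank F E := by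
  have hq := one_lt_natCard_subfield F
  have hn := finrank_subfield_pos F
  have hle : Module.finrank F U' ≤ Module.finrank F E := by
    by_contra! hlt
    exact linearSet_ne_univ_of_le hW U hU.le (h ▸ linearSet_eq_univ_of_lt hW U' hlt)
  have hne : (linearSet U).Nonempty := by
    have : U ≠ ⊥ := by
      rintro rfl
      rw [finrank_bot] at hU
      omega
    obtain ⟨u, hu, hu0⟩ := Submodule.exists_mem_ne_zero_of_ne_bot this
    exact ⟨_, u, hu0, hu, rfl⟩
  obtain ⟨P, hP, hmin⟩ := Set.exists_min_image (linearSet U)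
    (fun P => Module.finrank F (slice U P)) (Set.toFinite _) hne
  obtain ⟨h1, h2⟩ := smul_mem_of_pow_eq hW U hU hP rfl hmin
  have hd0 := (finrank_slice_pos_iff U P).2 hP
  have hd1 : Module.finrank F (slice U P) = 1 := by
    by_contra hd
    obtain ⟨a, ha, haF⟩ := exists_pow_eq_notMem F (by omega) h1
    exact haF (mem_of_smul_mem hmax (h2 a ha))
  -- A point of weight one gives at least `q ^ (n - 1)` points, while `U'` defines fewer than `q ^
  -- rank U'`.
  have h3 := pow_le_ncard_linearSet hW U hU hP
  rw [hd1, ← h] at h3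
  have h4 := (Nat.pow_lt_pow_iff_right hq).1 (h3.trans_lt (ncard_linearSet_lt U'))
  omega

end RankUniqueness

/-! ### Subspaces with a point of weight at least `n - 1`. -/

section HeavyPoint

variable {E W : Type*} [Field E] [AddCommGroup W] [Module E W] {F : Subfield E}

/-- The coefficients `h` for which `h • p` lies in `U`. -/
def coeffSubmodule (U : Submodule F W) (p : W) : Submodule F E :=
  U.comap ((LinearMap.toSpanSingleton E W p).restrictScalars F)

theorem finrank_coeffSubmodule (U : Submodule F W) {p : W} (hp : p ≠ 0) :
    Module.finrank F (coeffSubmodule U p) =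
      Module.finrank F (slice U (Projectivization.mk E p hp)) := by
  have : slice U (Projectivization.mk E p hp) = (coeffSubmodule U p).map
      ((LinearMap.toSpanSingleton E W p).restrictScalars F) := by
    ext x
    rw [mem_slice_mk, Submodule.mem_map]
    constructor
    · rintro ⟨hx, a, rfl⟩
      exact ⟨a, hx, rfl⟩
    · rintro ⟨a, ha, rfl⟩
      exact ⟨ha, a, rfl⟩
  rw [this]
  exact (Submodule.equivMapOfInjective _ (smul_left_injective E hp) _).finrank_eq

theorem exists_ker_eq_of_finrank_add_one [Finite E] (H : Submodule F E)
    (hH : Module.finrank F H + 1 = Module.finrank F E) :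
    ∃ ψ : E →ₗ[F] F, ψ ≠ 0 ∧ LinearMap.ker ψ = H := by
  obtain ⟨ψ, hψ, hle⟩ := H.exists_le_ker_of_lt_top (lt_top_iff_ne_top.2 fun h => by
    rw [h, finrank_top] at hH
    omega)
  refine ⟨ψ, hψ, (Submodule.eq_of_le_of_finrank_eq hle ?_).symm⟩
  have h1 := LinearMap.finrank_range_add_finrank_ker ψ
  have h2 : LinearMap.range ψ = ⊤ := LinearMap.range_eq_top.2 (LinearMap.surjective hψ)
  rw [h2, finrank_top, Module.finrank_self] at h1
  omega

/-- Any two hyperplanes of `E` over `F` are multiples of each other. -/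
theorem exists_mul_mem_iff_mem [Finite E] (H₁ H₂ : Submodule F E)
    (h₁ : Module.finrank F H₁ + 1 = Module.finrank F E)
    (h₂ : Module.finrank F H₂ + 1 = Module.finrank F E) :
    ∃ a : E, a ≠ 0 ∧ ∀ x, a * x ∈ H₂ ↔ x ∈ H₁ := by
  obtain ⟨ψ₁, hψ₁, rfl⟩ := exists_ker_eq_of_finrank_add_one H₁ h₁
  obtain ⟨ψ₂, hψ₂, rfl⟩ := exists_ker_eq_of_finrank_add_one H₂ h₂
  -- The map sending `a` to `ψ₂ (a * ·)` is injective between spaces of equal dimension, so every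
  -- functional, in particular `ψ₁`, has this form.
  let μ : E →ₗ[F] (E →ₗ[F] F) := (LinearMap.llcomp F E E F ψ₂) ∘ₗ LinearMap.mul F E
  have hμ : ∀ a x, μ a x = ψ₂ (a * x) := fun a x => rfl
  have hinj : Function.Injective μ := by
    rw [injective_iff_map_eq_zero]
    intro a ha
    by_contra h0
    refine hψ₂ (LinearMap.ext fun x => ?_)
    have := LinearMap.congr_fun ha (a⁻¹ * x)
    rwa [hμ, mul_inv_cancel_left₀ h0] at this
  have hfin : Module.finrank F E = Module.finrank F (E →ₗ[F] F) := by
    rw [Module.finrank_linearMap, Module.finrank_self, mul_one]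
  obtain ⟨a, ha⟩ := (LinearMap.injective_iff_surjective_of_finrank_eq_finrank hfin).1 hinj ψ₁
  refine ⟨a, fun h0 => hψ₁ ?_, fun x => ?_⟩
  · rw [← ha, h0, map_zero]
  · rw [LinearMap.mem_ker, LinearMap.mem_ker, ← ha, hμ]

theorem le_restrictScalars_of_linearSet_eq {U U' : Submodule F W} {P : ℙ E W}
    (h : U ≤ P.submodule.restrictScalars F) (hL : linearSet U' = linearSet U) :
    U' ≤ P.submodule.restrictScalars F := by
  intro u hu
  by_cases hu0 : u = 0
  · rw [hu0]; exact Submodule.zero_mem _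
  · have h1 : Projectivization.mk E u hu0 ∈ linearSet U := hL ▸ ⟨u, hu0, hu, rfl⟩
    obtain ⟨x, hx0, hx, hxu⟩ := h1
    refine (mem_submodule_iff_mk_eq hu0 P).2 ?_
    rw [← hxu]
    exact (mem_submodule_iff_mk_eq hx0 P).1 (h hx)

theorem GammaLEquivalent.refl (A : Set W) : GammaLEquivalent E A A :=
  ⟨RingEquiv.refl E, ⟨⟨id, fun _ _ => rfl⟩, fun _ _ => rfl⟩, Function.bijective_id, Set.image_id A⟩

variable [Finite W]

theorem eq_restrictScalars_of_slice [Finite E] {U : Submodule F W}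
    (hU : Module.finrank F U = Module.finrank F E) {P : ℙ E W}
    (h : U ≤ P.submodule.restrictScalars F) : U = P.submodule.restrictScalars F := by
  refine Submodule.eq_of_le_of_finrank_eq h ?_
  rw [hU, finrank_restrictScalars_subfield, P.finrank_submodule, mul_one]

/-- Coordinates in which a subspace of rank `n` with a point of weight `n - 1` is a product. -/
theorem exists_basis_of_heavy_point (hW : Module.finrank E W = 2) {U : Submodule F W}
    (hU : Module.finrank F U = Module.finrank F E) {p : W} (hp : p ≠ 0)
    (hs : Module.finrank F (slice U (Projectivization.mk E p hp)) + 1 = Module.finrank F E) :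
    ∃ b : Module.Basis (Fin 2) E W,
      ∀ w, w ∈ U ↔ b.coord 0 w ∈ coeffSubmodule U p ∧ b.coord 1 w ∈ F := by
  set S := slice U (Projectivization.mk E p hp) with hS
  obtain ⟨e, he, heS⟩ : ∃ e ∈ U, e ∉ S := by
    by_contra! h
    have h1 := Submodule.finrank_mono (show U ≤ S from h)
    omega
  have hep : e ∉ Submodule.span E {p} := fun h => heS
    ((mem_slice_mk hp).2 ⟨he, Submodule.mem_span_singleton.1 h⟩)
  obtain ⟨b, hb0, hb1⟩ := exists_basis_pair hW hp hep
  have hsum : ∀ w, w = b.coord 0 w • p + b.coord 1 w • e := fun w => by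
    conv_lhs => rw [← b.sum_repr w, Fin.sum_univ_two, hb0, hb1]
    rfl
  have hc0p : b.coord 0 p = 1 := by rw [← hb0]; simp
  have hc1p : b.coord 1 p = 0 := by rw [← hb0]; simp
  have hc0e : b.coord 0 e = 0 := by rw [← hb1]; simp
  have hc1e : b.coord 1 e = 1 := by rw [← hb1]; simp
  -- One vector `e` of `U` off the point suffices, as `S` has corank one in `U`; in the basis `p, e`
  -- this is a product decomposition.
  have hsup : U = S ⊔ Submodule.span F {e} := by
    symm
    refine Submodule.eq_of_le_of_finrank_le
      (sup_le inf_le_left (by simpa using he)) ?_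
    have h1 : S < S ⊔ Submodule.span F {e} := lt_of_le_of_ne le_sup_left fun h => heS <| by
      rw [h]; exact Submodule.mem_sup_right (Submodule.mem_span_singleton_self e)
    have h2 := Submodule.finrank_lt_finrank_of_lt h1
    omega
  refine ⟨b, fun w => ⟨fun hw => ?_, fun ⟨h0, h1⟩ => ?_⟩⟩
  · rw [hsup, Submodule.mem_sup] at hw
    obtain ⟨s, hs, x, hx, rfl⟩ := hw
    obtain ⟨c, rfl⟩ := Submodule.mem_span_singleton.1 hx
    rw [hS, mem_slice_mk] at hs
    obtain ⟨hsU, a, rfl⟩ := hs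
    have hce : c • e = (c : E) • e := rfl
    rw [hce]
    simp only [map_add, map_smul, hc0p, hc1p, hc0e, hc1e, smul_eq_mul, mul_one, mul_zero,
      add_zero, zero_add]
    exact ⟨hsU, c.2⟩
  · rw [hsum w]
    exact U.add_mem h0 (U.smul_mem ⟨_, h1⟩ he)

/-- Two subspaces of rank `n` defining the same linear set and having points of weight at least
`n - 1` are equivalent. -/
theorem gammaLEquivalent_of_heavy_points [Finite E] (hW : Module.finrank E W = 2)
    {U₁ U₂ : Submodule F W}
    (h₁ : Module.finrank F U₁ = Module.finrank F E) (h₂ : Module.finrank F U₂ = Module.finrank F E)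
    (hL : linearSet U₁ = linearSet U₂) {P₁ P₂ : ℙ E W}
    (hP₁ : Module.finrank F E ≤ Module.finrank F (slice U₁ P₁) + 1)
    (hP₂ : Module.finrank F E ≤ Module.finrank F (slice U₂ P₂) + 1) :
    GammaLEquivalent E (U₁ : Set W) (U₂ : Set W) := by
  -- With weight `n` the subspace is a full point. The linear set is then that point, and the other
  -- subspace fills it too.
  have key : ∀ (U U' : Submodule F W) (P : ℙ E W), Module.finrank F U = Module.finrank F E →
      Module.finrank F U' = Module.finrank F E → linearSet U' = linearSet U →
      Module.finrank F (slice U P) = Module.finrank F E → U = U' := by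
    intro U U' P hU hU' hL h
    have h1 : slice U P = U :=
      Submodule.eq_of_le_of_finrank_eq inf_le_left (h.trans hU.symm)
    have h2 : U ≤ P.submodule.restrictScalars F := h1 ▸ inf_le_right
    rw [eq_restrictScalars_of_slice hU h2,
      eq_restrictScalars_of_slice hU' (le_restrictScalars_of_linearSet_eq h2 hL)]
  have hle : ∀ (U : Submodule F W) (P : ℙ E W), Module.finrank F U = Module.finrank F E →
      Module.finrank F (slice U P) ≤ Module.finrank F E := fun U P hU =>
    hU ▸ Submodule.finrank_mono inf_le_left
  by_cases he₁ : Module.finrank F (slice U₁ P₁) = Module.finrank F E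
  · rw [key U₁ U₂ P₁ h₁ h₂ hL.symm he₁]
    exact .refl _
  by_cases he₂ : Module.finrank F (slice U₂ P₂) = Module.finrank F E
  · rw [key U₂ U₁ P₂ h₂ h₁ hL he₂]
    exact .refl _
  have hs₁ : Module.finrank F (slice U₁ P₁) + 1 = Module.finrank F E := by
    have := hle U₁ P₁ h₁
    omega
  have hs₂ : Module.finrank F (slice U₂ P₂) + 1 = Module.finrank F E := by
    have := hle U₂ P₂ h₂
    omega
  induction P₁ using Projectivization.ind with
  | h p₁ hp₁ =>
  induction P₂ using Projectivization.ind with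
  | h p₂ hp₂ =>
  obtain ⟨b₁, hb₁⟩ := exists_basis_of_heavy_point hW h₁ hp₁ hs₁
  obtain ⟨b₂, hb₂⟩ := exists_basis_of_heavy_point hW h₂ hp₂ hs₂
  rw [← finrank_coeffSubmodule] at hs₁ hs₂
  obtain ⟨a, ha0, ha⟩ := exists_mul_mem_iff_mem _ _ hs₁ hs₂
  -- Both subspaces are hyperplane times `F`; scaling the first coordinate by `a` matches the
  -- hyperplanes.
  let f : W →ₗ[E] W := (b₁.coord 0).smulRight (a • b₂ 0) + (b₁.coord 1).smulRight (b₂ 1)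
  have hf0 : ∀ w, b₂.coord 0 (f w) = a * b₁.coord 0 w := fun w => by simp [f, mul_comm]
  have hf1 : ∀ w, b₂.coord 1 (f w) = b₁.coord 1 w := fun w => by simp [f]
  have hinj : Function.Injective f := by
    rw [injective_iff_map_eq_zero]
    intro w hw
    refine b₁.ext_elem fun i => ?_
    have h0 := hf0 w
    have h1 := hf1 w
    rw [hw, map_zero] at h0 h1
    fin_cases i
    · simpa [ha0] using h0.symm
    · simpa using h1.symm
  have hbij : Function.Bijective f := Finite.injective_iff_bijective.1 hinj
  have hmem : ∀ w, f w ∈ U₂ ↔ w ∈ U₁ := fun w => by rw [hb₁, hb₂, hf0, hf1, ha]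
  refine ⟨RingEquiv.refl E, ⟨f.toAddHom, fun c x => f.map_smul c x⟩, hbij, ?_⟩
  ext w
  constructor
  · rintro ⟨u, hu, rfl⟩
    exact (hmem u).2 hu
  · intro hw
    obtain ⟨u, rfl⟩ := hbij.2 w
    exact ⟨u, (hmem u).1 hw, rfl⟩

end HeavyPoint

/-! ### Cones and linear blocking sets of Rédei type. -/

section Cone

theorem mk_mem_linearSet_iff {E V : Type*} [Field E] [AddCommGroup V] [Module E V]
    {F : Subfield E} (U : Submodule F V) {x : V} (hx : x ≠ 0) :
    Projectivization.mk E x hx ∈ linearSet U ↔ ∃ a : E, a ≠ 0 ∧ a • x ∈ U := by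
  constructor
  · rintro ⟨u, hu, huU, h⟩
    obtain ⟨a, ha⟩ := (Projectivization.mk_eq_mk_iff' ..).1 h
    exact ⟨a, fun h0 => hu (by rw [← ha, h0, zero_smul]), ha ▸ huU⟩
  · rintro ⟨a, ha, h⟩
    exact ⟨a • x, smul_ne_zero ha hx, h, (Projectivization.mk_eq_mk_iff' ..).2 ⟨a, rfl⟩⟩

variable {E V : Type*} [Field E] [AddCommGroup V] [Module E V] {F : Subfield E}
  {W : Submodule E V}

theorem mk_mem_pointsOf_iff {x : V} (hx : x ≠ 0) (l : Submodule E V) :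
    Projectivization.mk E x hx ∈ pointsOf l ↔ x ∈ l := by
  simp [pointsOf, Submodule.span_singleton_le_iff_mem]

theorem add_coe_notMem {v : V} (hv : v ∉ W) (w : W) : v + w ∉ W := fun h =>
  hv ((W.add_mem_iff_left w.2).1 h)

theorem add_coe_ne_zero {v : V} (hv : v ∉ W) (w : W) : v + w ≠ 0 := fun h =>
  add_coe_notMem hv w (h ▸ W.zero_mem)

theorem coe_ne_zero_of_ne_zero {w : W} (hw : w ≠ 0) : (w : V) ≠ 0 := fun h => hw (Subtype.ext h)

theorem mk_coe_mem_image_iff {w : W} (hw : w ≠ 0) (L : Set (ℙ E W)) :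
    Projectivization.mk E (w : V) (coe_ne_zero_of_ne_zero hw) ∈
      Projectivization.map W.subtype W.injective_subtype '' L ↔
        Projectivization.mk E w hw ∈ L := by
  constructor
  · rintro ⟨P, hP, h⟩
    induction P using Projectivization.ind with
    | h x hx =>
      rw [Projectivization.map_mk, Projectivization.mk_eq_mk_iff'] at h
      obtain ⟨a, ha⟩ := h
      have : Projectivization.mk E x hx = Projectivization.mk E w hw :=
        (Projectivization.mk_eq_mk_iff' ..).2 ⟨a, Subtype.ext ha⟩
      exact this ▸ hP
  · intro h
    exact ⟨_, h, rfl⟩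

/-- A linear functional with kernel `W` and value `1` at `v`. -/
theorem exists_coordinate [Finite V] (hV : Module.finrank E V = 3) (hW : Module.finrank E W = 2)
    {v : V} (hv : v ∉ W) :
    ∃ φ : V →ₗ[E] E, φ v = 1 ∧ ∀ x, x ∈ W ↔ φ x = 0 := by
  obtain ⟨φ, hφv, hle⟩ := Submodule.exists_le_ker_of_notMem hv
  have hker : W = LinearMap.ker φ := by
    refine Submodule.eq_of_le_of_finrank_eq hle ?_
    have h1 := LinearMap.finrank_range_add_finrank_ker φ
    have h2 : LinearMap.range φ = ⊤ := LinearMap.range_eq_top.2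
      (LinearMap.surjective fun h => hφv (by rw [h]; rfl))
    rw [h2, finrank_top, Module.finrank_self] at h1
    omega
  refine ⟨(φ v)⁻¹ • φ, by simp [hφv], fun x => ?_⟩
  conv_lhs => rw [hker, LinearMap.mem_ker]
  simp [hφv]

/-- A point is on the line `PG(W, E)` or has the form `⟨v + w⟩`. -/
theorem point_cases [Finite V] (hV : Module.finrank E V = 3) (hW : Module.finrank E W = 2)
    {v : V} (hv : v ∉ W) (P : ℙ E V) :
    (∃ (w : W) (hw : w ≠ 0), P = Projectivization.mk E (w : V) (coe_ne_zero_of_ne_zero hw)) ∨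
      ∃ w : W, P = Projectivization.mk E (v + w) (add_coe_ne_zero hv w) := by
  obtain ⟨φ, hφv, hφ⟩ := exists_coordinate hV hW hv
  induction P using Projectivization.ind with
  | h x hx =>
    by_cases h : x ∈ W
    · exact Or.inl ⟨⟨x, h⟩, fun h => hx (congrArg Subtype.val h), rfl⟩
    · have h0 : φ x ≠ 0 := fun h' => h ((hφ x).2 h')
      refine Or.inr ⟨⟨(φ x)⁻¹ • x - v, (hφ _).2 (by simp [h0, hφv])⟩, ?_⟩
      exact (Projectivization.mk_eq_mk_iff' ..).2 ⟨φ x, by simp [h0]⟩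

/-- The `F`-subspace spanned by a subspace of `W` and a vector `v`. -/
def cone (U : Submodule F W) (v : V) : Submodule F V :=
  U.map (W.subtype.restrictScalars F) ⊔ Submodule.span F {v}

theorem mem_cone {U : Submodule F W} {v x : V} :
    x ∈ cone U v ↔ ∃ u ∈ U, ∃ c : F, (u : V) + c • v = x := by
  simp only [cone, Submodule.mem_sup, Submodule.mem_map, Submodule.mem_span_singleton]
  constructor
  · rintro ⟨_, ⟨u, hu, rfl⟩, _, ⟨c, rfl⟩, rfl⟩
    exact ⟨u, hu, c, rfl⟩
  · rintro ⟨u, hu, c, rfl⟩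
    exact ⟨_, ⟨u, hu, rfl⟩, _, ⟨c, rfl⟩, rfl⟩

theorem coe_mem_cone_iff {U : Submodule F W} {v : V} (hv : v ∉ W) (w : W) :
    (w : V) ∈ cone U v ↔ w ∈ U := by
  rw [mem_cone]
  constructor
  · rintro ⟨u, hu, c, h⟩
    have hc : (c : E) = 0 := by
      by_contra hc
      refine hv ((W.smul_mem_iff hc).1 ?_)
      rw [show (c : E) • v = w - u from eq_sub_of_add_eq' h]
      exact W.sub_mem w.2 u.2
    have hc' : c = 0 := Subtype.ext hc
    rw [hc', zero_smul, add_zero] at h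
    rwa [← Subtype.ext h]
  · intro hw
    exact ⟨w, hw, 0, by rw [zero_smul, add_zero]⟩

theorem mk_coe_mem_linearSet_cone_iff {U : Submodule F W} {v : V} (hv : v ∉ W) {w : W}
    (hw : w ≠ 0) :
    Projectivization.mk E (w : V) (coe_ne_zero_of_ne_zero hw) ∈ linearSet (cone U v) ↔
      Projectivization.mk E w hw ∈ linearSet U := by
  rw [mk_mem_linearSet_iff, mk_mem_linearSet_iff]
  refine exists_congr fun a => and_congr_right fun _ => ?_
  exact coe_mem_cone_iff hv (a • w)

/-- If `a • (v + w) = u + c • v`, comparison modulo `W` gives `a = c`, a scalar of `F`, which can be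
cancelled. Thus the affine points of the cone determine `U`. -/
theorem mk_add_mem_linearSet_cone_iff {U : Submodule F W} {v : V} (hv : v ∉ W) (w : W) :
    Projectivization.mk E (v + w) (add_coe_ne_zero hv w) ∈ linearSet (cone U v) ↔ w ∈ U := by
  rw [mk_mem_linearSet_iff]
  constructor
  · rintro ⟨a, ha, h⟩
    obtain ⟨u, hu, c, h⟩ := mem_cone.1 h
    have hca : (c : E) = a := by
      by_contra hne
      refine hv ((W.smul_mem_iff (sub_ne_zero.2 hne)).1 ?_)
      have h1 : ((c : E) - a) • v = a • (w : V) - u := by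
        rw [sub_smul, show (c : E) • v = a • (v + (w : V)) - u from eq_sub_of_add_eq' h, smul_add]
        abel
      rw [h1]
      exact W.sub_mem (W.smul_mem a w.2) u.2
    have h2 : (u : V) = a • (w : V) := by
      have h3 : (u : V) + (c : E) • v = a • (v + (w : V)) := h
      rw [hca, smul_add, add_comm] at h3
      exact add_left_cancel h3
    have h4 : u = c • w := Subtype.ext (by rw [h2, ← hca]; rfl)
    have hc0 : c ≠ 0 := fun h0 => ha (by rw [← hca, h0]; rfl)
    rw [h4] at hu
    exact (U.smul_mem_iff hc0).1 hu
  · intro hw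
    refine ⟨1, one_ne_zero, mem_cone.2 ⟨w, hw, 1, ?_⟩⟩
    rw [one_smul, one_smul, add_comm]

theorem linearSet_cone_inter_pointsOf [Finite V] (hV : Module.finrank E V = 3)
    (hW : Module.finrank E W = 2) {U : Submodule F W} {v : V} (hv : v ∉ W) :
    linearSet (cone U v) ∩ pointsOf W =
      Projectivization.map W.subtype W.injective_subtype '' linearSet U := by
  ext P
  rcases point_cases hV hW hv P with ⟨w, hw, rfl⟩ | ⟨w, rfl⟩
  · rw [Set.mem_inter_iff, mk_mem_pointsOf_iff, mk_coe_mem_image_iff hw,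
      mk_coe_mem_linearSet_cone_iff hv hw]
    simp
  · rw [Set.mem_inter_iff, mk_mem_pointsOf_iff]
    constructor
    · rintro ⟨-, h⟩
      exact absurd h (add_coe_notMem hv w)
    · rintro ⟨Q, -, h⟩
      induction Q using Projectivization.ind with
      | h x hx =>
        have h1 : Projectivization.mk E (v + w) (add_coe_ne_zero hv w) ∈ pointsOf W := by
          rw [← h, Projectivization.map_mk, mk_mem_pointsOf_iff]
          exact x.2
        rw [mk_mem_pointsOf_iff] at h1
        exact absurd h1 (add_coe_notMem hv w)

/-- The points `⟨v + u⟩` with `u` in `U`. -/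
def affinePoints (U : Submodule F W) {v : V} (hv : v ∉ W) : Set (ℙ E V) :=
  (fun u : W => Projectivization.mk E (v + u) (add_coe_ne_zero hv u)) '' (U : Set W)

theorem mk_add_injective {v : V} (hv : v ∉ W) :
    Function.Injective fun u : W => Projectivization.mk E (v + u) (add_coe_ne_zero hv u) := by
  intro x y h
  obtain ⟨a, ha⟩ := (Projectivization.mk_eq_mk_iff' ..).1 h
  have ha1 : a = 1 := by
    by_contra hne
    refine hv ((W.smul_mem_iff (sub_ne_zero.2 hne)).1 ?_)
    have h1 : (a - 1) • v = (x : V) - a • (y : V) := by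
      have h2 : a • v = v + x - a • (y : V) := by
        rw [smul_add] at ha
        exact eq_sub_of_add_eq ha
      rw [sub_smul, one_smul, h2]
      abel
    rw [h1]
    exact W.sub_mem x.2 (W.smul_mem a y.2)
  rw [ha1, one_smul] at ha
  exact Subtype.ext (add_left_cancel ha).symm

theorem ncard_affinePoints (U : Submodule F W) {v : V} (hv : v ∉ W) :
    (affinePoints U hv).ncard = Nat.card U :=
  Set.ncard_image_of_injective _ (mk_add_injective hv)

theorem linearSet_cone_diff_pointsOf [Finite V] (hV : Module.finrank E V = 3)
    (hW : Module.finrank E W = 2) {U : Submodule F W} {v : V} (hv : v ∉ W) :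
    linearSet (cone U v) \ pointsOf W = affinePoints U hv := by
  ext P
  constructor
  · rintro ⟨hP, hPW⟩
    rcases point_cases hV hW hv P with ⟨w, hw, rfl⟩ | ⟨w, rfl⟩
    · exact absurd ((mk_mem_pointsOf_iff _ _).2 w.2) hPW
    · exact ⟨w, (mk_add_mem_linearSet_cone_iff hv w).1 hP, rfl⟩
  · rintro ⟨w, hw, rfl⟩
    exact ⟨(mk_add_mem_linearSet_cone_iff hv w).2 hw, fun h =>
      add_coe_notMem hv w ((mk_mem_pointsOf_iff _ _).1 h)⟩

theorem finrank_cone [Finite V] (U : Submodule F W) {v : V} (hv : v ∉ W) :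
    Module.finrank F (cone U v) = Module.finrank F U + 1 := by
  have h1 := Submodule.finrank_sup_add_finrank_inf_eq (U.map (W.subtype.restrictScalars F))
    (Submodule.span F {v})
  have h2 : U.map (W.subtype.restrictScalars F) ⊓ Submodule.span F {v} = ⊥ := by
    rw [Submodule.eq_bot_iff]
    rintro x ⟨⟨u, -, rfl⟩, hx⟩
    obtain ⟨c, hc⟩ := Submodule.mem_span_singleton.1 hx
    have hc0 : (c : E) = 0 := by
      by_contra h
      refine hv ((W.smul_mem_iff h).1 ?_)
      rw [show (c : E) • v = (u : V) from hc]
      exact u.2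
    have hc0' : c = 0 := Subtype.ext hc0
    rw [← hc, hc0', zero_smul]
  have hv0 : v ≠ 0 := fun h => hv (h ▸ W.zero_mem)
  have h3 : Module.finrank F (U.map (W.subtype.restrictScalars F)) = Module.finrank F U :=
    (Submodule.equivMapOfInjective _ (fun x y h => Subtype.ext h) U).finrank_eq.symm
  rw [h2, finrank_bot, finrank_span_singleton hv0, h3] at h1
  exact h1

/-- A line has rank `2 * n` inside rank `3 * n`, so it meets every subspace of rank above `n`. -/
theorem isBlockingSet_of_finrank [Finite E] [Finite V] (hV : Module.finrank E V = 3)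
    (T : Submodule F V) (hT : Module.finrank F E < Module.finrank F T) :
    IsBlockingSet (linearSet T) := by
  intro l hl
  have h1 := Submodule.finrank_sup_add_finrank_inf_eq T (l.restrictScalars F)
  have h2 := Submodule.finrank_le (T ⊔ l.restrictScalars F)
  rw [finrank_subfield_eq_mul F V, hV] at h2
  rw [finrank_restrictScalars_subfield, hl] at h1
  have h3 : T ⊓ l.restrictScalars F ≠ ⊥ := by
    intro h
    rw [h, finrank_bot] at h1
    omega
  obtain ⟨x, ⟨hxT, hxl⟩, hx⟩ := Submodule.exists_mem_ne_zero_of_ne_bot h3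
  exact ⟨_, ⟨x, hx, hxT, rfl⟩, (mk_mem_pointsOf_iff hx l).2 hxl⟩

variable [Finite E] [Finite V]

/-- The cone over a subspace of rank `n` defines a blocking set of Rédei type. -/
theorem isLinearRedeiBlockingSetOver_cone (hV : Module.finrank E V = 3)
    (hW : Module.finrank E W = 2) {U : Submodule F W} {L : Set (ℙ E W)} (hL : linearSet U = L)
    (hU : Module.finrank F U = Module.finrank F E) {v : V} (hv : v ∉ W) :
    IsLinearRedeiBlockingSetOver F W L (linearSet (cone U v)) where
  isLinearSet := ⟨_, rfl⟩
  isBlockingSet := isBlockingSet_of_finrank hV _ (by rw [finrank_cone U hv, hU]; omega)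
  isRedeiLine := by
    have hmap : (Projectivization.map W.subtype W.injective_subtype).Injective := by
      intro P Q h
      induction P using Projectivization.ind with
      | h x hx =>
      induction Q using Projectivization.ind with
      | h y hy =>
      rw [Projectivization.map_mk, Projectivization.map_mk, Projectivization.mk_eq_mk_iff'] at h
      obtain ⟨a, ha⟩ := h
      exact (Projectivization.mk_eq_mk_iff' ..).2 ⟨a, Subtype.ext ha⟩
    have h1 : (linearSet (cone U v) ∩ pointsOf W).ncard = (linearSet U).ncard := by
      rw [linearSet_cone_inter_pointsOf hV hW hv, Set.ncard_image_of_injective _ hmap]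
    have h2 := Set.ncard_inter_add_ncard_sdiff_eq_ncard (linearSet (cone U v)) (pointsOf W)
      (Set.toFinite _)
    rw [linearSet_cone_diff_pointsOf hV hW hv, ncard_affinePoints, natCard_submodule_eq_pow,
      hU, ← natCard_eq_pow_finrank_subfield, h1] at h2
    have h3 := ncard_linearSet_lt U
    rw [hU, ← natCard_eq_pow_finrank_subfield] at h3
    exact ⟨hW, (linearSet U).ncard, by omega, by omega, h1⟩
  inter_eq := by rw [linearSet_cone_inter_pointsOf hV hW hv, hL]

/-- Every linear blocking set of Rédei type comes from a cone. -/
theorem exists_eq_linearSet_cone (hV : Module.finrank E V = 3) (hW : Module.finrank E W = 2)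
    {L : Set (ℙ E W)}
    (hrank : ∀ U : Submodule F W, linearSet U = L → Module.finrank F U = Module.finrank F E)
    {B : Set (ℙ E V)} (hB : IsLinearRedeiBlockingSetOver F W L B) :
    ∃ (U : Submodule F W) (v : V), v ∉ W ∧ linearSet U = L ∧ linearSet (cone U v) = B := by
  obtain ⟨⟨T, rfl⟩, -, ⟨-, N, hN, -, hN'⟩, hinter⟩ := hB
  have hdiff := Set.ncard_inter_add_ncard_sdiff_eq_ncard (linearSet T) (pointsOf W)
    (Set.toFinite _)
  have hdiff' : (linearSet T \ pointsOf W).ncard = Nat.card E := by omega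
  let U : Submodule F W := T.comap (W.subtype.restrictScalars F)
  have hmem : ∀ w : W, w ∈ U ↔ (w : V) ∈ T := fun w => Iff.rfl
  have hLw : ∀ (w : W) (hw : w ≠ 0), Projectivization.mk E w hw ∈ L ↔
      Projectivization.mk E (w : V) (coe_ne_zero_of_ne_zero hw) ∈ linearSet T := by
    intro w hw
    rw [← mk_coe_mem_image_iff hw, ← hinter, Set.mem_inter_iff, mk_mem_pointsOf_iff]
    simp
  have hUL : linearSet U = L := by
    ext P
    induction P using Projectivization.ind with
    | h w hw =>
      rw [hLw, mk_mem_linearSet_iff, mk_mem_linearSet_iff]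
      rfl
  have hUn := hrank U hUL
  obtain ⟨P, ⟨t, ht0, htT, rfl⟩, htW⟩ : (linearSet T \ pointsOf W).Nonempty := by
    rw [← Set.ncard_pos, hdiff']
    exact Nat.card_pos
  rw [mk_mem_pointsOf_iff] at htW
  have hsub : affinePoints U htW ⊆ linearSet T \ pointsOf W := by
    rintro _ ⟨u, hu, rfl⟩
    exact ⟨⟨_, add_coe_ne_zero htW u, T.add_mem htT hu, rfl⟩, fun h =>
      add_coe_notMem htW u ((mk_mem_pointsOf_iff _ _).1 h)⟩
  -- The Rédei condition leaves exactly `q ^ n` points of `B` off the line, and `U`, being of rank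
  -- `n`, already supplies that many. Nothing is assumed about the rank of `T`.
  have heq : affinePoints U htW = linearSet T \ pointsOf W := by
    refine Set.eq_of_subset_of_ncard_le hsub ?_
    rw [ncard_affinePoints, hdiff', natCard_submodule_eq_pow, hUn,
      ← natCard_eq_pow_finrank_subfield]
  refine ⟨U, t, htW, hUL, ?_⟩
  rw [← Set.inter_union_sdiff (linearSet (cone U t)) (pointsOf W),
    ← Set.inter_union_sdiff (linearSet T) (pointsOf W), linearSet_cone_diff_pointsOf hV hW htW, heq,
    linearSet_cone_inter_pointsOf hV hW htW, hinter, hUL]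

end Cone

/-! ### Equivalence of cones versus equivalence of subspaces. -/

section Equivalence

theorem GammaLEquivalent.symm {E V : Type*} [Field E] [AddCommGroup V] [Module E V] {A B : Set V}
    (h : GammaLEquivalent E A B) : GammaLEquivalent E B A := by
  obtain ⟨σ, f, hf, rfl⟩ := h
  let e := Equiv.ofBijective f hf
  have he : ∀ v, f (e.symm v) = v := fun v => e.apply_symm_apply v
  refine ⟨σ.symm, ⟨⟨e.symm, fun x y => hf.injective ?_⟩, fun a x => hf.injective ?_⟩,
    e.symm.bijective, ?_⟩
  · simp [he]
  · simp [he, map_smulₛₗ]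
  · exact e.symm_image_image A

variable {E V : Type*} [Field E] [AddCommGroup V] [Module E V] {F : Subfield E}
  {W : Submodule E V}

theorem mk_congr_of_eq {x y : V} (hx : x ≠ 0) (h : x = y) :
    Projectivization.mk E x hx = Projectivization.mk E y (h ▸ hx) := by
  subst h; rfl

theorem exists_smul_map_mem_iff {V' : Type*} [AddCommGroup V'] [Module E V'] {σ : E ≃+* E}
    (f : V →ₛₗ[(σ : E →+* E)] V') (A : Set V) (A' : Set V') (h : ∀ x, f x ∈ A' ↔ x ∈ A) (x : V) :
    (∃ b : E, b ≠ 0 ∧ b • f x ∈ A') ↔ ∃ a : E, a ≠ 0 ∧ a • x ∈ A := by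
  constructor
  · rintro ⟨b, hb, hbx⟩
    refine ⟨σ.symm b, by simpa using hb, (h _).1 ?_⟩
    rw [map_smulₛₗ]
    simpa using hbx
  · rintro ⟨a, ha, hax⟩
    refine ⟨σ a, by simpa using ha, ?_⟩
    have := (h _).2 hax
    rwa [map_smulₛₗ] at this

theorem image_map_eq_of_iff {σ : E ≃+* E} (g : V →ₛₗ[(σ : E →+* E)] V) (hg : Function.Bijective g)
    {A B : Set (ℙ E V)} (h : ∀ P, Projectivization.map g hg.injective P ∈ B ↔ P ∈ A) :
    Projectivization.map g hg.injective '' A = B := by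
  ext P
  constructor
  · rintro ⟨Q, hQ, rfl⟩
    exact (h Q).2 hQ
  · intro hP
    induction P using Projectivization.ind with
    | h x hx =>
      obtain ⟨y, rfl⟩ := hg.2 x
      have hy : y ≠ 0 := fun h0 => hx (by rw [h0, map_zero])
      exact ⟨Projectivization.mk E y hy, (h _).1 hP, rfl⟩

theorem mk_apply_mem_image_iff {σ : E ≃+* E} (g : V →ₛₗ[(σ : E →+* E)] V)
    (hg : Function.Bijective g) {A : Set (ℙ E V)} {x : V} (hx : x ≠ 0) (hgx : g x ≠ 0) :
    Projectivization.mk E (g x) hgx ∈ Projectivization.map g hg.injective '' A ↔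
      Projectivization.mk E x hx ∈ A := by
  constructor
  · rintro ⟨Q, hQ, h⟩
    induction Q using Projectivization.ind with
    | h y hy =>
      rw [Projectivization.map_mk] at h
      obtain ⟨a, ha⟩ := (Projectivization.mk_eq_mk_iff' ..).1 h
      have h1 : Projectivization.mk E y hy = Projectivization.mk E x hx := by
        refine (Projectivization.mk_eq_mk_iff' ..).2 ⟨σ.symm a, hg.1 ?_⟩
        rw [map_smulₛₗ, ← ha]
        simp
      exact h1 ▸ hQ
  · intro h
    exact ⟨_, h, rfl⟩

/-- Equivalent subspaces of `W` give equivalent cones. -/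
theorem pGammaLEquivalent_cone [Finite V] (hV : Module.finrank E V = 3)
    (hW : Module.finrank E W = 2) {U₁ U₂ : Submodule F W} {v₁ v₂ : V} (hv₁ : v₁ ∉ W)
    (hv₂ : v₂ ∉ W) (h : GammaLEquivalent E (U₁ : Set W) (U₂ : Set W)) :
    PGammaLEquivalent (linearSet (cone U₁ v₁)) (linearSet (cone U₂ v₂)) := by
  obtain ⟨σ, f, hf, himg⟩ := h
  have hmem : ∀ w, f w ∈ (U₂ : Set W) ↔ w ∈ (U₁ : Set W) := fun w => by
    rw [← himg, hf.1.mem_set_image]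
  obtain ⟨φ, hφv, hφ⟩ := exists_coordinate hV hW hv₁
  let π : V →ₗ[E] W := LinearMap.codRestrict W (LinearMap.id - φ.smulRight v₁) fun x => by
    rw [hφ]
    simp [hφv]
  have hπ : ∀ x, (π x : V) = x - φ x • v₁ := fun x => rfl
  -- The `σ`-semilinear extension of `f` that sends `v₁` to `v₂`.
  let g : V →ₛₗ[(σ : E →+* E)] V :=
    { toFun := fun x => (f (π x) : V) + σ (φ x) • v₂
      map_add' := fun x y => by
        simp only [map_add, Submodule.coe_add, add_smul]
        abel
      map_smul' := fun a x => by
        simp [map_smulₛₗ, mul_smul] }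
  have hg : ∀ x, g x = (f (π x) : V) + σ (φ x) • v₂ := fun x => rfl
  have hgw : ∀ w : W, g w = f w := fun w => by
    have h0 : φ w = 0 := (hφ _).1 w.2
    have h1 : π w = w := Subtype.ext (by rw [hπ, h0, zero_smul, sub_zero])
    rw [hg, h1, h0, map_zero, zero_smul, add_zero]
  have hgv : ∀ w : W, g (v₁ + w) = v₂ + f w := fun w => by
    have h1 : π v₁ = 0 := Subtype.ext (by rw [hπ, hφv, one_smul, sub_self]; rfl)
    rw [map_add, hgw, hg, h1, hφv, map_zero, map_one, one_smul]
    simp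
  have hinj : Function.Injective g := by
    rw [injective_iff_map_eq_zero]
    intro x hx
    rw [hg] at hx
    have h1 : φ x = 0 := by
      by_contra h0
      refine hv₂ ((W.smul_mem_iff (show σ (φ x) ≠ 0 by simpa using h0)).1 ?_)
      rw [← neg_eq_of_add_eq_zero_right hx]
      exact W.neg_mem (f (π x)).2
    rw [h1, map_zero, zero_smul, add_zero] at hx
    have h2 : π x = 0 := hf.1 (Subtype.ext (by rw [hx, map_zero]; rfl))
    have h3 := hπ x
    rw [h1, zero_smul, sub_zero, h2] at h3
    exact h3.symm
  have hbij : Function.Bijective g := Finite.injective_iff_bijective.1 hinj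
  refine ⟨σ, g, hbij, image_map_eq_of_iff g hbij fun P => ?_⟩
  rcases point_cases hV hW hv₁ P with ⟨w, hw, rfl⟩ | ⟨w, rfl⟩
  · have hfw : f w ≠ 0 := fun h0 => hw (hf.1 (by rw [h0, map_zero]))
    rw [mk_coe_mem_linearSet_cone_iff hv₁ hw, Projectivization.map_mk,
      mk_congr_of_eq _ (hgw w), mk_coe_mem_linearSet_cone_iff hv₂ hfw, mk_mem_linearSet_iff,
      mk_mem_linearSet_iff]
    exact exists_smul_map_mem_iff f _ _ hmem w
  · rw [mk_add_mem_linearSet_cone_iff hv₁, Projectivization.map_mk, mk_congr_of_eq _ (hgv w),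
      mk_add_mem_linearSet_cone_iff hv₂]
    exact hmem w

/-- A collineation between cones that fixes the line `PG(W, E)` restricts to an equivalence. -/
theorem gammaLEquivalent_of_map_mem [Finite V] (hV : Module.finrank E V = 3)
    (hW : Module.finrank E W = 2) {U₁ U₂ : Submodule F W} {v : V} (hv : v ∉ W) {σ : E ≃+* E}
    (g : V →ₛₗ[(σ : E →+* E)] V) (hg : Function.Bijective g)
    (himg : Projectivization.map g hg.injective '' linearSet (cone U₁ v) = linearSet (cone U₂ v))
    (hgW : ∀ w : W, g w ∈ W) : GammaLEquivalent E (U₁ : Set W) (U₂ : Set W) := by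
  obtain ⟨φ, hφv, hφ⟩ := exists_coordinate hV hW hv
  have hdecomp : ∀ x, ∃ w : W, x = w + φ x • v := fun x =>
    ⟨⟨x - φ x • v, (hφ _).2 (by simp [hφv])⟩, by simp⟩
  obtain ⟨w₀, hw₀⟩ := hdecomp (g v)
  set a := φ (g v) with ha
  have ha0 : a ≠ 0 := by
    intro h0
    obtain ⟨x, hx⟩ := hg.2 v
    obtain ⟨w, hw⟩ := hdecomp x
    refine hv ?_
    rw [← hx, hw, map_add, map_smulₛₗ, hw₀, h0, zero_smul, add_zero]
    exact W.add_mem (hgW w) (W.smul_mem _ w₀.2)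
  -- Since `g v = w₀ + a • v`, dividing by `a` normalizes `⟨g (v + u)⟩` to `⟨v + (a⁻¹ • w₀ + f u)⟩`,
  -- so `f` carries `U₁` to `U₂` up to a translation. The case `u = 0` puts the translation vector
  -- in `U₂`.
  let f : W →ₛₗ[(σ : E →+* E)] W :=
    { toFun := fun w => a⁻¹ • ⟨g w, hgW w⟩
      map_add' := fun x y => by
        rw [← smul_add]
        congr 1
        exact Subtype.ext (map_add g _ _)
      map_smul' := fun c x => by
        rw [smul_comm]
        congr 1
        exact Subtype.ext (map_smulₛₗ g _ _) }
  have hf : ∀ w, (f w : V) = a⁻¹ • g w := fun w => rfl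
  have hinj : Function.Injective f := by
    intro x y h
    have h1 := congrArg (Subtype.val) h
    rw [hf, hf] at h1
    exact Subtype.ext (hg.1 (smul_right_injective V (inv_ne_zero ha0) h1))
  have hbij : Function.Bijective f := Finite.injective_iff_bijective.1 hinj
  have hmem : ∀ u : W, a⁻¹ • w₀ + f u ∈ U₂ ↔ u ∈ U₁ := by
    intro u
    have hne : g (v + u) ≠ 0 := fun h0 => add_coe_ne_zero hv u (hg.1 (by rw [h0, map_zero]))
    rw [← mk_add_mem_linearSet_cone_iff hv, ← mk_add_mem_linearSet_cone_iff hv,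
      ← mk_apply_mem_image_iff g hg (add_coe_ne_zero hv u) hne, himg]
    have : Projectivization.mk E (g (v + u)) hne = Projectivization.mk E
        (v + (a⁻¹ • w₀ + f u : W)) (add_coe_ne_zero hv _) := by
      refine (Projectivization.mk_eq_mk_iff' ..).2 ⟨a, ?_⟩
      rw [map_add, hw₀, Submodule.coe_add, hf, Submodule.coe_smul, smul_add, smul_add,
        smul_inv_smul₀ ha0, smul_inv_smul₀ ha0]
      abel
    rw [this]
  have h0 : a⁻¹ • w₀ ∈ U₂ := by
    have := (hmem 0).2 U₁.zero_mem
    rwa [map_zero, add_zero] at this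
  refine ⟨σ, f, hbij, ?_⟩
  ext w
  constructor
  · rintro ⟨u, hu, rfl⟩
    exact (U₂.add_mem_iff_right h0).1 ((hmem u).2 hu)
  · intro hw
    obtain ⟨u, rfl⟩ := hbij.2 w
    exact ⟨u, (hmem u).1 (U₂.add_mem h0 hw), rfl⟩

/-- The elements of `F` are exactly the roots of `X ^ q - X` in `E`, and `σ` permutes these roots.
-/
theorem ringEquiv_mem_subfield [Finite E] (σ : E ≃+* E) {c : E} (hc : c ∈ F) : σ c ∈ F := by
  have := Fintype.ofFinite F
  have h1 : c ^ Fintype.card F = c :=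
    congrArg Subtype.val (FiniteField.pow_card (⟨c, hc⟩ : F))
  have h2 := congrArg (fun P => Polynomial.aeval (σ c) P) (prod_X_sub_C_eq_X_pow_card_sub_X F)
  simp only [map_prod, map_sub, Polynomial.aeval_X, Polynomial.aeval_C, map_pow] at h2
  rw [← map_pow, h1, sub_self, Finset.prod_eq_zero_iff] at h2
  obtain ⟨d, -, hd⟩ := h2
  rw [sub_eq_zero.1 hd]
  exact d.2

/-- If a collineation between cones moves the line `PG(W, E)`, then the image has a point of weight
at least `n - 1` on this line. -/
theorem exists_heavy_point_of_map_notMem [Finite E] [Finite V] (hV : Module.finrank E V = 3)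
    (hW : Module.finrank E W = 2) {U₁ U₂ : Submodule F W}
    (hrank : ∀ U : Submodule F W, linearSet U = linearSet U₁ →
      Module.finrank F U = Module.finrank F E)
    {v : V} (hv : v ∉ W) {σ : E ≃+* E}
    (g : V →ₛₗ[(σ : E →+* E)] V) (hg : Function.Bijective g)
    (himg : Projectivization.map g hg.injective '' linearSet (cone U₁ v) = linearSet (cone U₂ v))
    {w₁ : W} (hw₁ : g w₁ ∉ W) :
    ∃ P : ℙ E W, Module.finrank F E ≤ Module.finrank F (slice U₂ P) + 1 := by
  have hq := one_lt_natCard_subfield F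
  obtain ⟨φ, hφv, hφ⟩ := exists_coordinate hV hW hv
  -- The part of `W` that `g` sends into the second cone. It defines the same linear set as `U₁`, so
  -- its rank is `n`.
  let T : Submodule F W :=
    { carrier := {w | g w ∈ cone U₂ v}
      add_mem' := fun {x y} hx hy => by
        have := (cone U₂ v).add_mem hx hy
        rwa [← map_add] at this
      zero_mem' := by simp
      smul_mem' := fun c x hx => by
        have := (cone U₂ v).smul_mem ⟨σ c, ringEquiv_mem_subfield σ c.2⟩ hx
        have h1 : g ((c • x : W) : V) = σ c • g x := map_smulₛₗ g (c : E) (x : V)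
        change g ((c • x : W) : V) ∈ cone U₂ v
        rw [h1]
        exact this }
  have hTmem : ∀ w : W, w ∈ T ↔ g w ∈ cone U₂ v := fun w => Iff.rfl
  have hTL : linearSet T = linearSet U₁ := by
    ext P
    induction P using Projectivization.ind with
    | h w hw =>
      have hw' := coe_ne_zero_of_ne_zero hw
      have hgw : g w ≠ 0 := fun h0 => hw' (hg.1 (by rw [h0, map_zero]))
      rw [← mk_coe_mem_linearSet_cone_iff (U := U₁) hv hw, ← mk_apply_mem_image_iff g hg hw' hgw,
        himg, mk_mem_linearSet_iff, mk_mem_linearSet_iff]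
      exact (exists_smul_map_mem_iff g {x | g x ∈ cone U₂ v} (cone U₂ v) (fun x => Iff.rfl)
        (w : V)).symm
  have hTn := hrank T hTL
  -- The `v`-coordinate of `g t` lies in `F`, so the kernel has at least `q ^ (n - 1)` elements. As
  -- `g` is only semilinear, the count is done with additive groups.
  let χ : T →+ E :=
    { toFun := fun t => φ (g (t : W))
      map_zero' := by simp
      map_add' := fun x y => by simp }
  have hχ : ∀ t, χ t = φ (g (t : W)) := fun t => rfl
  have hχF : (χ.range : Set E) ⊆ F := by
    rintro _ ⟨t, rfl⟩
    obtain ⟨u, -, c, h⟩ := mem_cone.1 ((hTmem t).1 t.2)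
    have hu : φ u = 0 := (hφ _).1 u.2
    have : c • v = (c : E) • v := rfl
    rw [hχ, ← h, map_add, hu, this, map_smul, hφv, zero_add, smul_eq_mul, mul_one]
    exact c.2
  have hker : Nat.card F ^ Module.finrank F E ≤ Nat.card χ.ker * Nat.card F := by
    rw [← hTn, ← natCard_submodule_eq_pow, ← AddSubgroup.card_mul_index χ.ker,
      AddSubgroup.index_ker]
    exact Nat.mul_le_mul_left _ (Nat.card_mono (Set.toFinite _) hχF)
  have hw₁0 : w₁ ≠ 0 := by
    rintro rfl
    exact hw₁ (by simp)
  rcases Nat.lt_or_ge 1 (Nat.card χ.ker) with hcard | hcard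
  swap
  -- A trivial kernel forces `n ≤ 1`, and then any point will do.
  · refine ⟨Projectivization.mk E w₁ hw₁0, ?_⟩
    have h1 : Nat.card F ^ Module.finrank F E ≤ Nat.card F ^ 1 := by
      rw [pow_one]
      exact hker.trans ((Nat.mul_le_mul_right _ hcard).trans_eq (one_mul _))
    have h2 := (Nat.pow_le_pow_iff_right hq).1 h1
    omega
  have hgker : ∀ k : χ.ker, g ((k : T) : W) ∈ W := fun k => (hφ _).2 k.2
  obtain ⟨⟨k₀, hk₀⟩, hk₀0⟩ : ∃ k : χ.ker, k ≠ 0 := by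
    have := Finite.one_lt_card_iff_nontrivial.1 hcard
    exact exists_ne 0
  have hk₀0' : (k₀ : W) ≠ 0 := fun h => hk₀0 (Subtype.ext (Subtype.ext h))
  have hgk₀ : g (k₀ : W) ∈ W := hgker ⟨k₀, hk₀⟩
  have hne : (⟨g (k₀ : W), hgk₀⟩ : W) ≠ 0 := fun h =>
    hk₀0' (Subtype.ext (hg.1 ((congrArg Subtype.val h).trans (map_zero g).symm)))
  -- Two independent kernel vectors would span `W`, and `g` would map `W` into itself, contrary to
  -- `hw₁`. So `g` sends the kernel into `U₂` on one point.
  have hspan : ∀ k : χ.ker, ((k : T) : W) ∈ Submodule.span E {(k₀ : W)} := by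
    intro k
    by_contra hk
    obtain ⟨b, hb0, hb1⟩ := exists_basis_pair hW hk₀0' hk
    refine hw₁ ?_
    rw [← b.sum_repr w₁, Fin.sum_univ_two, hb0, hb1, Submodule.coe_add, Submodule.coe_smul,
      Submodule.coe_smul, map_add, map_smulₛₗ, map_smulₛₗ]
    exact W.add_mem (W.smul_mem _ hgk₀) (W.smul_mem _ (hgker k))
  refine ⟨Projectivization.mk E _ hne, ?_⟩
  let ι : χ.ker → slice U₂ (Projectivization.mk E _ hne) := fun k =>
    ⟨⟨g ((k : T) : W), hgker k⟩, (mem_slice_mk hne).2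
      ⟨(coe_mem_cone_iff hv _).1 ((hTmem _).1 k.1.2), by
        obtain ⟨c, hc⟩ := Submodule.mem_span_singleton.1 (hspan k)
        refine ⟨σ c, Subtype.ext ?_⟩
        rw [Submodule.coe_smul]
        simp only [← hc, Submodule.coe_smul, map_smulₛₗ]
        rfl⟩⟩
  have hι : Function.Injective ι := by
    intro x y h
    have h1 : g ((x : T) : W) = g ((y : T) : W) :=
      congrArg (fun z : slice U₂ (Projectivization.mk E _ hne) => ((z : W) : V)) h
    exact Subtype.ext (Subtype.ext (Subtype.ext (hg.1 h1)))
  have h1 := Nat.card_le_card_of_injective ι hι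
  rw [natCard_submodule_eq_pow] at h1
  rw [← Nat.pow_le_pow_iff_right hq, pow_succ]
  exact hker.trans (Nat.mul_le_mul_right _ h1)

/-- Equivalent cones come from equivalent subspaces of `W`. -/
theorem gammaLEquivalent_of_pGammaLEquivalent_cone [Finite E] [Finite V]
    (hV : Module.finrank E V = 3) (hW : Module.finrank E W = 2) {U₁ U₂ : Submodule F W}
    (hL : linearSet U₁ = linearSet U₂)
    (hrank : ∀ U : Submodule F W, linearSet U = linearSet U₁ →
      Module.finrank F U = Module.finrank F E)
    {v : V} (hv : v ∉ W)
    (h : PGammaLEquivalent (linearSet (cone U₁ v)) (linearSet (cone U₂ v))) :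
    GammaLEquivalent E (U₁ : Set W) (U₂ : Set W) := by
  have key : ∀ U U' : Submodule F W, linearSet U = linearSet U₁ →
      PGammaLEquivalent (linearSet (cone U v)) (linearSet (cone U' v)) →
      ¬ GammaLEquivalent E (U : Set W) (U' : Set W) →
      ∃ P : ℙ E W, Module.finrank F E ≤ Module.finrank F (slice U' P) + 1 := by
    rintro U U' hU ⟨σ, g, hg, himg⟩ hne
    by_cases hgW : ∀ w : W, g w ∈ W
    · exact absurd (gammaLEquivalent_of_map_mem hV hW hv g hg himg hgW) hne
    · push Not at hgW
      obtain ⟨w₁, hw₁⟩ := hgW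
      exact exists_heavy_point_of_map_notMem hV hW (hU ▸ hrank) hv g hg himg hw₁
  -- Inequivalence would give heavy points on both sides, from the collineation and its inverse; but
  -- then the subspaces are equivalent.
  by_contra hne
  obtain ⟨P₂, hP₂⟩ := key U₁ U₂ rfl h hne
  obtain ⟨P₁, hP₁⟩ := key U₂ U₁ hL.symm h.symm fun h' => hne h'.symm
  exact hne (gammaLEquivalent_of_heavy_points hW (hrank _ rfl) (hrank _ hL.symm) hL hP₁ hP₂)

end Equivalence

/-! ### The count of classes. -/

theorem mainTheorem6 {E : Type*} [Field E] [Finite E] (F : Subfield E) (q n : ℕ)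
    (hq : Nat.card F = q) (hE : Nat.card E = q ^ n)
    {V : Type*} [AddCommGroup V] [Module E V] (hV : Module.finrank E V = 3)
    (W : Submodule E V) (hW : Module.finrank E W = 2)
    (U : Submodule F W) (hU : Module.finrank F U = n)
    (hmax : IsMaxFieldOfLinearity F F (linearSet U)) :
    HasGammaLClass F (linearSet U) (numInequivalentRedeiBlockingSets F W (linearSet U)) := by
  have : Module.Finite E V := Module.finite_of_finrank_pos (by omega)
  have : Finite V := Module.finite_of_finite E
  have hn : n = Module.finrank F E := by
    rw [natCard_eq_pow_finrank_subfield F, hq] at hE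
    exact (Nat.pow_right_injective (hq ▸ one_lt_natCard_subfield F) hE).symm
  rw [hn] at hU
  have hrank : ∀ U' : Submodule F W, linearSet U' = linearSet U →
      Module.finrank F U' = Module.finrank F E :=
    fun U' h => finrank_eq_of_linearSet_eq hW hU hmax h
  obtain ⟨v, hv⟩ : ∃ v, v ∉ W := by
    by_contra! h
    have h1 : W = ⊤ := eq_top_iff.2 fun x _ => h x
    rw [h1, finrank_top, hV] at hW
    omega
  have : Finite (ℙ E V) := inferInstance
  have : Finite (Quotient (redeiBlockingSetSetoid F W (linearSet U))) := inferInstance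
  constructor
  · let e := (Finite.equivFin (Quotient (redeiBlockingSetSetoid F W (linearSet U)))).symm
    -- One subspace is taken from a representative of each class. The vertices `v' i` may differ,
    -- which `pGammaLEquivalent_cone` permits.
    choose U' v' hv' hU' hB using fun i => exists_eq_linearSet_cone hV hW hrank (e i).out.2
    refine ⟨U', hU', fun i j hij h => hij (e.injective ?_)⟩
    rw [← (e i).out_eq, ← (e j).out_eq]
    refine Quotient.sound ?_
    change PGammaLEquivalent (e i).out.1 (e j).out.1
    rw [← hB i, ← hB j]
    exact pGammaLEquivalent_cone hV hW (hv' i) (hv' j) h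
  · rintro r ⟨U', hU', hne⟩
    -- Cones with a common vertex `v` turn pairwise inequivalent subspaces into distinct classes.
    let c : Fin r → Quotient (redeiBlockingSetSetoid F W (linearSet U)) := fun i =>
      Quotient.mk _ ⟨linearSet (cone (U' i) v),
        isLinearRedeiBlockingSetOver_cone hV hW (hU' i) (hrank _ (hU' i)) hv⟩
    have hc : Function.Injective c := by
      intro i j hij
      by_contra hne'
      have h1 : PGammaLEquivalent (linearSet (cone (U' i) v)) (linearSet (cone (U' j) v)) :=
        Quotient.exact hij
      exact hne i j hne' (gammaLEquivalent_of_pGammaLEquivalent_cone hV hW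
        ((hU' i).trans (hU' j).symm) (fun U'' h => hrank U'' (h.trans (hU' i))) hv h1)
    have h2 := Nat.card_le_card_of_injective c hc
    rwa [Nat.card_fin] at h2
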